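/- **Setting.** Let $\mathbb T=\mathbb R/\mathbb Z$, $d\in\mathbb N$, and let $\mathbb T^d$ carry normalized Lebesgue measure, $\langle f,g\rangle=\int_{\mathbb T^d} f\,\overline g\,dx$. Let $\psi\in L_2(\mathbb R)$ be real-valued, put $\psi_{j,k}(x)=2^{j/2}\psi(2^jx-k)$, and define the periodized wavelets $\psi^{\mathrm{per}}_{j,k}(x)=\sum_{\ell\in\mathbb Z}\psi_{j,k}(x+\ell)$ for $j\ge 0$, $k\in\mathcal I_j=\{0,\dots,2^j-1\}$, and $\psi^{\mathrm{per}}_{-1,0}=1$, $\mathcal I_{-1}=\{0\}$. Let $m\in\mathbb N$ and assume * (P1) $\operatorname{supp}\psi=[0,S]$; * (P2) $\int_{\mathbb R}\psi(x)x^\beta\,dx=0$ for $\beta=0,\dots,m-1$; * (P3) there are constants $0<\gamma\le\delta$ such that for every $j\ge 0$ and all complex $(c_k)_{k\in\mathcal I_j}$, $$\gamma\sum_{k\in\mathcal I_j}|c_k|^2\le\Big\|\sum_{k\in\mathcal I_j}c_k\psi^{\mathrm{per}}_{j,k}\Big\|_{L_2(\mathbb T)}^2\le\delta\sum_{k\in\mathcal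 I_j}|c_k|^2 .$$ For each $j\ge -1$ let $(\psi^{\mathrm{per},*}_{j,k})_{k\in\mathcal I_j}$ be the dual basis of $(\psi^{\mathrm{per}}_{j,k})_{k\in\mathcal I_j}$ in $\operatorname{span}\{\psi^{\mathrm{per}}_{j,l}: l\in\mathcal I_j\}$, i.e. $\psi^{\mathrm{per},*}_{j,k}$ belongs to this span and $\langle\psi^{\mathrm{per}}_{j,l},\psi^{\mathrm{per},*}_{j,k}\rangle=\delta_{k,l}$ for $k,l\in\mathcal I_j$. For $\boldsymbol j\in\mathbb Z^d$ with $\boldsymbol j\ge-\boldsymbol 1$ let $\mathcal I_{\boldsymbol j}=\mathcal I_{j_1}\times\dots\times\mathcal I_{j_d}$, $\psi^{\mathrm{per},*}_{\boldsymbol j,\boldsymbol k}(\boldsymbol x)=\prod_{i=1}^d\psi^{\mathrm{per},*}_{j_i,k_i}(x_i)$ and $|\boldsymbol j|_1=\sum_{i:\,j_i\ge0}j_i$. For $s>0$ and $f\in L_2(\mathbb T^d)$ with Fourier coefficients $c_{\boldsymbol k}(f)$ put $$\|f\|_{H^s_{\mathrm{mix}}(\mathbb T^d)}^2=\sum_{\boldsymbol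 k\in\mathbb Z^d}|c_{\boldsymbol k}(f)|^2\prod_{i=1}^d(1+|k_i|^2)^s\in[0,\infty],$$ and, for a fixed integer $r>s$, $$\|f\|_{\boldsymbol B^s_{2,\infty}(\mathbb T^d)}=\sum_{u\subseteq\{1,\dots,d\}}\ \sup_{0<|h_i|\le1,\,i\in u}\Big(\prod_{i\in u}|h_i|^{-s}\Big)\big\|\Delta^{r,u}_{\boldsymbol h}f\big\|_{L_2(\mathbb T^d)}\in[0,\infty],$$ where $\Delta^{r,u}_{\boldsymbol h}=\prod_{i\in u}\Delta^r_{h_i,i}$ and $\Delta^r_{h,i}f(\boldsymbol x)=\sum_{n=0}^r(-1)^{r-n}\binom rn f(\boldsymbol x+nh\boldsymbol e_i)$. **Theorem.** Let $0<s<m$. There is a constant $C>0$, depending only on $m,s,d$, on the difference order $r$, and on the constants $S,\gamma,\delta$ of the wavelet, such that for all $f\in L_2(\mathbb T^d)$ $$\Big(\sum_{\boldsymbol j\ge-\boldsymbol 1}2^{2|\boldsymbol j|_1s}\sum_{\boldsymbol k\in\mathcal I_{\boldsymbol j}}|\langle f,\psi^{\mathrm{per},*}_{\boldsymbol j,\boldsymbol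 k}\rangle|^2\Big)^{1/2}\le C\,\|f\|_{H^s_{\mathrm{mix}}(\mathbb T^d)}$$ and $$\sup_{\boldsymbol j\ge-\boldsymbol 1}2^{|\boldsymbol j|_1s}\Big(\sum_{\boldsymbol k\in\mathcal I_{\boldsymbol j}}|\langle f,\psi^{\mathrm{per},*}_{\boldsymbol j,\boldsymbol k}\rangle|^2\Big)^{1/2}\le C\,\|f\|_{\boldsymbol B^s_{2,\infty}(\mathbb T^d)} .$$ -/

import Mathlib

open MeasureTheory
open scoped ENNReal NNReal

namespace MixedWavelet

noncomputable section

/-! ## The torus -/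

/-- The normalised Lebesgue (Haar) measure on the one-dimensional torus `𝕋 = ℝ / ℤ`. -/
abbrev circleMeasure : Measure UnitAddCircle := AddCircle.haarAddCircle

/-- The normalised Lebesgue measure on `𝕋ᵈ`. -/
abbrev torusMeasure (d : ℕ) : Measure (UnitAddTorus (Fin d)) :=
  Measure.pi fun _ => circleMeasure

/-! ## Periodised wavelets -/

/-- `ψ_{j,k}(x) = 2^{j/2} ψ(2^j x - k)`. -/
def dilate (ψ : ℝ → ℝ) (j k : ℤ) (x : ℝ) : ℝ :=
  (2 : ℝ) ^ ((j : ℝ) / 2) * ψ ((2 : ℝ) ^ j * x - k)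

theorem periodic_tsum (g : ℝ → ℝ) :
    Function.Periodic (fun x : ℝ => ∑' l : ℤ, g (x + l)) 1 := by
  intro x
  have h := (Equiv.addRight (1 : ℤ)).tsum_eq (fun l : ℤ => g (x + l))
  refine Eq.trans (tsum_congr fun l => ?_) h
  simp only [Equiv.coe_addRight, Int.cast_add, Int.cast_one]
  congr 1
  ring

/-- The `1`-periodisation `x ↦ ∑_{l ∈ ℤ} g(x + l)`, as a function on `ℝ / ℤ`. -/
def periodize (g : ℝ → ℝ) : UnitAddCircle → ℝ :=
  (periodic_tsum g).lift

/-- The periodised wavelets `ψ^per_{j,k}` for `j ≥ 0`; on the level `j = -1` the periodised scaling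
function, which is the constant function `1`. -/
def perWavelet (ψ : ℝ → ℝ) (j k : ℤ) : UnitAddCircle → ℂ :=
  fun x => if 0 ≤ j then (periodize (dilate ψ j k) x : ℂ) else 1

/-- The index set `I_j`: it is `{0, …, 2^j - 1}` for `j ≥ 0` and `{0}` for `j = -1`. -/
def levelIndex (j : ℤ) : Finset ℤ :=
  if 0 ≤ j then Finset.Ico 0 (2 ^ j.toNat) else {0}

/-- The index set `I_j = I_{j_1} × ⋯ × I_{j_d}`. -/
def multiIndex {d : ℕ} (j : Fin d → ℤ) : Finset (Fin d → ℤ) :=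
  Fintype.piFinset fun i => levelIndex (j i)

/-- `|j|₁ = ∑_{i, j_i ≥ 0} j_i`. -/
def absOne {d : ℕ} (j : Fin d → ℤ) : ℤ :=
  ∑ i with 0 ≤ j i, j i

/-- The levels `j ≥ -1` (componentwise). -/
abbrev Level (d : ℕ) : Type := {j : Fin d → ℤ // ∀ i, -1 ≤ j i}

/-! ## The properties of the wavelet -/

/-- (P1) Compact support: `supp ψ = [0, S]`. -/
def HasSupport (ψ : ℝ → ℝ) (S : ℝ) : Prop :=
  tsupport ψ = Set.Icc 0 S

/-- (P2) Vanishing moments of order `m`. -/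
def HasVanishingMoments (ψ : ℝ → ℝ) (m : ℕ) : Prop :=
  ∀ β < m, ∫ x, ψ x * x ^ β = 0

/-- (P3) For every level `j ≥ 0` the functions `ψ^per_{j,k}`, `k ∈ I_j`, form a Riesz basis (of their
span) with constants `γ` and `δ` that do not depend on `j`. -/
def IsPeriodicRiesz (ψ : ℝ → ℝ) (γ δ : ℝ) : Prop :=
  ∀ j : ℤ, 0 ≤ j → ∀ c : ℤ → ℂ,
    ENNReal.ofReal γ * ∑ k ∈ levelIndex j, ‖c k‖ₑ ^ 2
        ≤ eLpNorm (fun x => ∑ k ∈ levelIndex j, c k * perWavelet ψ j k x) 2 circleMeasure ^ 2 ∧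
      eLpNorm (fun x => ∑ k ∈ levelIndex j, c k * perWavelet ψ j k x) 2 circleMeasure ^ 2
        ≤ ENNReal.ofReal δ * ∑ k ∈ levelIndex j, ‖c k‖ₑ ^ 2

/-- `ψ'_{j,k}` (`j ≥ -1`, `k ∈ I_j`) are the dual wavelets: on every level `j`, the family
`(ψ'_{j,k})_{k ∈ I_j}` is the dual basis of `(ψ^per_{j,k})_{k ∈ I_j}` inside the span of the latter,
that is `ψ'_{j,k} ∈ span {ψ^per_{j,l} | l ∈ I_j}` (almost everywhere) and
`⟨ψ^per_{j,l}, ψ'_{j,k}⟩ = δ_{k,l}`. -/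
def IsDual (ψ : ℝ → ℝ) (ψ' : ℤ → ℤ → UnitAddCircle → ℂ) : Prop :=
  ∀ j : ℤ, -1 ≤ j → ∀ k ∈ levelIndex j,
    (∃ c : ℤ → ℂ,
      ψ' j k =ᵐ[circleMeasure] fun x => ∑ l ∈ levelIndex j, c l * perWavelet ψ j l x) ∧
    ∀ l ∈ levelIndex j,
      ∫ x, perWavelet ψ j l x * (starRingEnd ℂ) (ψ' j k x) ∂circleMeasure = if k = l then 1 else 0

/-- Tensor products `∏_i η_{j_i,k_i}(x_i)` of a univariate system `η`. -/
def tensor {d : ℕ} (η : ℤ → ℤ → UnitAddCircle → ℂ) (j k : Fin d → ℤ) :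
    UnitAddTorus (Fin d) → ℂ :=
  fun x => ∏ i, η (j i) (k i) (x i)

/-- `⟨f, g⟩ = ∫_{𝕋ᵈ} f(x) conj(g(x)) dx`. -/
def innerL2 {d : ℕ} (f g : UnitAddTorus (Fin d) → ℂ) : ℂ :=
  ∫ x, f x * (starRingEnd ℂ) (g x) ∂(torusMeasure d)

/-- `∑_{k ∈ I_j} |⟨f, η_{j,k}⟩|²`. -/
def levelEnergy {d : ℕ} (η : ℤ → ℤ → UnitAddCircle → ℂ) (f : UnitAddTorus (Fin d) → ℂ)
    (j : Fin d → ℤ) : ℝ≥0∞ :=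
  ∑ k ∈ multiIndex j, ‖innerL2 f (tensor η j k)‖ₑ ^ 2

/-! ## Function spaces of dominating mixed smoothness -/

/-- The norm of `H^s_mix(𝕋ᵈ)`:
`‖f‖² = ∑_{k ∈ ℤᵈ} |c_k(f)|² ∏_i (1 + |k_i|²)^s` (possibly infinite). -/
def hmixNorm {d : ℕ} (s : ℝ) (f : UnitAddTorus (Fin d) → ℂ) : ℝ≥0∞ :=
  (∑' k : Fin d → ℤ, ‖UnitAddTorus.mFourierCoeff f k‖ₑ ^ 2 *
    ENNReal.ofReal (∏ i, (1 + (k i : ℝ) ^ 2) ^ s)) ^ (1 / 2 : ℝ)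

/-- The `r`-th difference with step `h` in the `i`-th coordinate. -/
def coordDiff {d : ℕ} (r : ℕ) (i : Fin d) (h : ℝ) (f : UnitAddTorus (Fin d) → ℂ) :
    UnitAddTorus (Fin d) → ℂ :=
  fun x => ∑ n ∈ Finset.range (r + 1), (-1 : ℂ) ^ (r - n) * (r.choose n : ℂ) *
    f (x + Pi.single i (((n : ℝ) * h : ℝ) : UnitAddCircle))

/-- The mixed difference operator `Δ_h^{r,u} = ∏_{i ∈ u} Δ_{h_i,i}^r` (the identity for `u = ∅`).
The factors commute; they are applied in the order of the coordinates. -/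
def mixedDiff {d : ℕ} (r : ℕ) (u : Finset (Fin d)) (h : Fin d → ℝ)
    (f : UnitAddTorus (Fin d) → ℂ) : UnitAddTorus (Fin d) → ℂ :=
  u.sort.foldr (fun i g => coordDiff r i (h i) g) f

/-- The norm of `B^s_{2,∞}(𝕋ᵈ)` (possibly infinite), by mixed differences of order `r`:
`∑_{u ⊆ [d]} sup_{0 < |h_i| ≤ 1, i ∈ u} (∏_{i ∈ u} |h_i|^{-s}) ‖Δ_h^{r,u} f‖_{L₂}`. -/
def besovNorm {d : ℕ} (s : ℝ) (r : ℕ) (f : UnitAddTorus (Fin d) → ℂ) : ℝ≥0∞ :=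
  ∑ u : Finset (Fin d), ⨆ (h : Fin d → ℝ) (_ : ∀ i ∈ u, 0 < |h i| ∧ |h i| ≤ 1),
    ENNReal.ofReal (∏ i ∈ u, |h i| ^ (-s)) * eLpNorm (mixedDiff r u h f) 2 (torusMeasure d)

end

end MixedWavelet

namespace MixedWavelet

/-! ## Sums over products -/

/-! Everything is compared on the Fourier side. A combination of wavelets of level `j` is almost
orthogonal to frequencies `n` of dyadic level `l` below `j`: the vanishing moments make the Fourier
transform of `ψ` small of order `m` at the origin. At higher frequencies the Riesz bound and
Parseval suffice. Hence multiplying the squared Fourier coefficients by max(1, 4^(m(j-l))) still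
leaves a sum bounded by the ℓ² norm of the wavelet coefficients (`perWavelet_energy_le`). The dual
functions lie in the same span with comparable coefficients, so they inherit the bound
(`dual_energy_le`), and it tensorizes (`tensor_energy_le`).

Duality turns this into an estimate for analysis coefficients: testing `f` against the combination
of dual functions whose coefficients are those of `f` bounds the energy of level `j` by the squared
Fourier coefficients of `f`, damped by the inverse weight (`levelEnergy_le_of_energy_le`).

Since 0 < s < m, the factor 4^(js) times the inverse weight is at most 4^(ls) 4^(-σ|j-l|) in each
coordinate, with σ = min(s, m-s) (`level_interaction`). Summing the geometric decay over levels
gives the Sobolev bound. For the Besov bound it is summed over frequency blocks, each controlled by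
one mixed difference with steps matched to the block (`block_energy_le_besov`). -/

theorem tsum_pi_succ {α : Type*} {d : ℕ} (F : (Fin (d + 1) → α) → ℝ≥0∞) :
    ∑' x, F x = ∑' x' : Fin d → α, ∑' x₀ : α, F (Fin.cons x₀ x') := by
  rw [ENNReal.tsum_comm, ← ENNReal.tsum_prod,
    ← (Fin.consEquiv fun _ : Fin (d + 1) => α).tsum_eq F]
  rfl

theorem tsum_pi_prod {α : Type*} {d : ℕ} (g : Fin d → α → ℝ≥0∞) :
    ∑' x : Fin d → α, ∏ i, g i (x i) = ∏ i, ∑' a, g i a := by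
  induction d with
  | zero => simp
  | succ d ih =>
    rw [tsum_pi_succ, Fin.prod_univ_succ, ← ih fun i => g i.succ, ← ENNReal.tsum_mul_left]
    refine tsum_congr fun x' => ?_
    simp only [Fin.prod_univ_succ, Fin.cons_zero, Fin.cons_succ, ENNReal.tsum_mul_right]

theorem sum_piFinset_succ {α M : Type*} [DecidableEq α] [AddCommMonoid M] {d : ℕ}
    (K : Fin (d + 1) → Finset α) (F : (Fin (d + 1) → α) → M) :
    ∑ k ∈ Fintype.piFinset K, F k =
      ∑ k₀ ∈ K 0, ∑ k' ∈ Fintype.piFinset fun i => K i.succ, F (Fin.cons k₀ k') := by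
  rw [← Finset.sum_product']
  refine Finset.sum_bij' (fun k _ => (k 0, Fin.tail k)) (fun p _ => Fin.cons p.1 p.2)
    ?_ ?_ ?_ ?_ ?_
  · intro k hk
    simp only [Fintype.mem_piFinset, Finset.mem_product, Fin.tail] at hk ⊢
    exact ⟨hk 0, fun i => hk i.succ⟩
  · intro p hp
    simp only [Fintype.mem_piFinset, Finset.mem_product] at hp ⊢
    exact Fin.cases (by simpa using hp.1) (fun i => by simpa using hp.2 i)
  · intro k _
    simp
  · intro p _
    simp
  · intro k _
    simp

/-- Tensor products of matrices that are bounded from `ℓ²` to weighted `ℓ²` are bounded. -/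
theorem tensor_energy_le {α β : Type*} [DecidableEq α] {A : ℝ≥0∞} {d : ℕ}
    (K : Fin d → Finset α) (b : Fin d → α → β → ℂ) (v : Fin d → β → ℝ≥0∞)
    (h : ∀ i, ∀ y : α → ℂ, ∑' n, v i n * ‖∑ k ∈ K i, y k * b i k n‖ₑ ^ 2
      ≤ A * ∑ k ∈ K i, ‖y k‖ₑ ^ 2) (y : (Fin d → α) → ℂ) :
    ∑' n : Fin d → β, (∏ i, v i (n i)) *
        ‖∑ k ∈ Fintype.piFinset K, y k * ∏ i, b i (k i) (n i)‖ₑ ^ 2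
      ≤ A ^ d * ∑ k ∈ Fintype.piFinset K, ‖y k‖ₑ ^ 2 := by
  induction d with
  | zero => simp [Subsingleton.elim _ (default : Fin 0 → α)]
  | succ d ih =>
    have ih' := fun k₀ => ih (fun i => K i.succ) (fun i => b i.succ) (fun i => v i.succ)
      (fun i => h i.succ) fun k' => y (Fin.cons k₀ k')
    rw [tsum_pi_succ, sum_piFinset_succ]
    -- With n' frozen, the sum over k' is merely a coefficient indexed by k₀, so the first matrix
    -- can be estimated alone. The induction hypothesis then applies for each k₀ separately.
    calc _ = ∑' n' : Fin d → β, (∏ i, v i.succ (n' i)) * ∑' n₀, v 0 n₀ *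
            ‖∑ k₀ ∈ K 0, (∑ k' ∈ Fintype.piFinset fun i => K i.succ,
              y (Fin.cons k₀ k') * ∏ i, b i.succ (k' i) (n' i)) * b 0 k₀ n₀‖ₑ ^ 2 := by
          refine tsum_congr fun n' => ?_
          rw [← ENNReal.tsum_mul_left]
          refine tsum_congr fun n₀ => ?_
          simp only [Fin.prod_univ_succ, Fin.cons_zero, Fin.cons_succ, sum_piFinset_succ]
          rw [mul_comm (v 0 n₀), mul_assoc]
          congr 4
          refine Finset.sum_congr rfl fun k₀ _ => ?_
          rw [Finset.sum_mul]
          exact Finset.sum_congr rfl fun k' _ => by ring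
      _ ≤ ∑' n' : Fin d → β, (∏ i, v i.succ (n' i)) * (A * ∑ k₀ ∈ K 0,
            ‖∑ k' ∈ Fintype.piFinset fun i => K i.succ,
              y (Fin.cons k₀ k') * ∏ i, b i.succ (k' i) (n' i)‖ₑ ^ 2) :=
          ENNReal.tsum_le_tsum fun n' => mul_le_mul_right (h 0 _) _
      _ = A * ∑ k₀ ∈ K 0, ∑' n' : Fin d → β, (∏ i, v i.succ (n' i)) *
            ‖∑ k' ∈ Fintype.piFinset fun i => K i.succ,
              y (Fin.cons k₀ k') * ∏ i, b i.succ (k' i) (n' i)‖ₑ ^ 2 := by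
          rw [← Summable.tsum_finsetSum (L := .unconditional _) fun _ _ => ENNReal.summable,
            ← ENNReal.tsum_mul_left]
          refine tsum_congr fun n' => ?_
          rw [mul_left_comm, Finset.mul_sum]
      _ ≤ A * ∑ k₀ ∈ K 0, A ^ d * ∑ k' ∈ Fintype.piFinset fun i => K i.succ,
            ‖y (Fin.cons k₀ k')‖ₑ ^ 2 :=
          mul_le_mul_right (Finset.sum_le_sum fun k₀ _ => ih' k₀) _
      _ = _ := by rw [← Finset.mul_sum, ← mul_assoc, pow_succ']

/-! ## Dyadic frequency levels and the weights -/

/-- The number `l` with `2 ^ (l - 1) ≤ |n| < 2 ^ l`, respectively `0` for `n = 0`. -/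
def dyadicLevel (n : ℤ) : ℕ := n.natAbs.size

/-- `max(1, 4 ^ (m (j - l)))`, where `l` is the dyadic level of `n`. -/
noncomputable def freqWeight (m : ℕ) (j n : ℤ) : ℝ≥0∞ := 4 ^ (m * (j.toNat - dyadicLevel n))

theorem natAbs_lt_two_pow_dyadicLevel (n : ℤ) : n.natAbs < 2 ^ dyadicLevel n :=
  Nat.lt_size_self _

theorem two_pow_le_two_mul_natAbs {n : ℤ} (h : dyadicLevel n ≠ 0) :
    2 ^ dyadicLevel n ≤ 2 * n.natAbs := by
  obtain ⟨l, hl⟩ := Nat.exists_eq_succ_of_ne_zero h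
  have : 2 ^ l ≤ n.natAbs := Nat.lt_size.1 (by unfold dyadicLevel at hl; omega)
  rw [hl, Nat.succ_eq_add_one, pow_succ]
  omega

theorem freqWeight_ne_zero (m : ℕ) (j n : ℤ) : freqWeight m j n ≠ 0 := by
  simp [freqWeight]

theorem freqWeight_ne_top (m : ℕ) (j n : ℤ) : freqWeight m j n ≠ ⊤ := by
  simp [freqWeight]

/-- Interaction of the wavelet level `j` with the frequency level `l`. -/
theorem level_interaction {s σ : ℝ} {m : ℕ} (h₁ : σ ≤ s) (h₂ : σ ≤ m - s) (j l : ℕ) :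
    (2 : ℝ≥0∞) ^ (2 * (j : ℝ) * s) * (4 ^ (m * (j - l)))⁻¹
      ≤ 2 ^ (2 * (l : ℝ) * s) * 2 ^ (-(2 * σ * |(j : ℝ) - l|)) := by
  have h4 : (4 : ℝ≥0∞) ^ (m * (j - l)) = 2 ^ (2 * m * ((j - l : ℕ) : ℝ)) := by
    rw [show (4 : ℝ≥0∞) = 2 ^ 2 by norm_num, ← pow_mul, ← ENNReal.rpow_natCast]
    push_cast
    ring_nf
  rw [h4, ← ENNReal.rpow_neg, ← ENNReal.rpow_add _ _ two_ne_zero ENNReal.ofNat_ne_top,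
    ← ENNReal.rpow_add _ _ two_ne_zero ENNReal.ofNat_ne_top]
  refine ENNReal.rpow_le_rpow_of_exponent_le one_le_two ?_
  -- For j ≤ l the truncated subtraction makes the weight 1, and the decay comes from σ ≤ s. For l ≤
  -- j the weight exceeds 4^(s(j-l)) by a power with exponent m - s ≥ σ.
  rcases le_total j l with h | h
  · have h' : (j : ℝ) ≤ l := by exact_mod_cast h
    rw [Nat.sub_eq_zero_of_le h, abs_of_nonpos (by linarith)]
    push_cast
    nlinarith
  · have h' : (l : ℝ) ≤ j := by exact_mod_cast h
    rw [Nat.cast_sub h, abs_of_nonneg (by linarith)]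
    nlinarith

/-- The sum `∑_{i ∈ ℤ} 4 ^ (-σ |i|)`. -/
noncomputable def geomConst (σ : ℝ) : ℝ≥0∞ := ∑' i : ℤ, (2 : ℝ≥0∞) ^ (-(2 * σ * |(i : ℝ)|))

theorem geomConst_ne_top {σ : ℝ} (hσ : 0 < σ) : geomConst σ ≠ ⊤ := by
  have hq : (2 : ℝ) ^ (-(2 * σ)) < 1 := Real.rpow_lt_one_of_one_lt_of_neg one_lt_two (by linarith)
  have hs : Summable fun i : ℤ => (2 : ℝ) ^ (-(2 * σ * |(i : ℝ)|)) := by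
    have : Summable fun n : ℕ => (2 : ℝ) ^ (-(2 * σ * (n : ℝ))) := by
      refine (summable_geometric_of_lt_one (by positivity) hq).congr fun n => ?_
      rw [← Real.rpow_natCast, ← Real.rpow_mul zero_le_two]
      ring_nf
    refine Summable.of_nat_of_neg ?_ ?_ <;> simpa using this
  have h := hs.tsum_ofReal_ne_top
  simpa only [geomConst, ← ENNReal.ofReal_rpow_of_pos two_pos, ENNReal.ofReal_ofNat] using h

/-- The levels -1 and 0 share the same `toNat`. Replacing `j.toNat` by `j` changes the distance to
`l` by at most 1, which costs the factor 2^(2σ) and leaves a translate of the geometric series. -/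
theorem tsum_level_interaction_le (σ : ℝ) (hσ : 0 < σ) (l : ℕ) :
    ∑' j : {j : ℤ // -1 ≤ j}, (2 : ℝ≥0∞) ^ (-(2 * σ * |((j.1.toNat : ℕ) : ℝ) - l|))
      ≤ 2 ^ (2 * σ) * geomConst σ := by
  calc _ ≤ ∑' j : {j : ℤ // -1 ≤ j}, (2 : ℝ≥0∞) ^ (2 * σ) *
          2 ^ (-(2 * σ * |((j.1 - l : ℤ) : ℝ)|)) := by
        refine ENNReal.tsum_le_tsum fun j => ?_
        rw [← ENNReal.rpow_add _ _ two_ne_zero ENNReal.ofNat_ne_top]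
        refine ENNReal.rpow_le_rpow_of_exponent_le one_le_two ?_
        have h1 : |((j.1 - l : ℤ) : ℝ)| ≤ |((j.1.toNat : ℕ) : ℝ) - l| + 1 := by
          have : |j.1 - (l : ℤ)| ≤ |(j.1.toNat : ℤ) - l| + 1 := by
            have := j.2
            grind
          exact_mod_cast this
        nlinarith
    _ ≤ ∑' j : ℤ, (2 : ℝ≥0∞) ^ (2 * σ) * 2 ^ (-(2 * σ * |((j - l : ℤ) : ℝ)|)) :=
        ENNReal.tsum_comp_le_tsum_of_injective Subtype.val_injective
          fun j : ℤ => (2 : ℝ≥0∞) ^ (2 * σ) * 2 ^ (-(2 * σ * |((j - l : ℤ) : ℝ)|))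
    _ = _ := by
        rw [ENNReal.tsum_mul_left, geomConst]
        congr 1
        exact (Equiv.subRight (l : ℤ)).tsum_eq
          fun i : ℤ => (2 : ℝ≥0∞) ^ (-(2 * σ * |(i : ℝ)|))

theorem tsum_level_interaction_nat_le (σ : ℝ) (j : ℕ) :
    ∑' l : ℕ, (2 : ℝ≥0∞) ^ (-(2 * σ * |(j : ℝ) - l|)) ≤ geomConst σ := by
  have := ENNReal.tsum_comp_le_tsum_of_injective
    (f := fun l : ℕ => (j : ℤ) - l) (fun a b h => by simpa using h)
    fun i : ℤ => (2 : ℝ≥0∞) ^ (-(2 * σ * |(i : ℝ)|))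
  simpa [geomConst] using this

/-! ## `L²` norms and Parseval's identity -/

theorem enorm_sq_eq_ofReal (z : ℂ) : ‖z‖ₑ ^ 2 = ENNReal.ofReal (‖z‖ ^ 2) := by
  rw [ENNReal.ofReal_pow (norm_nonneg _), ofReal_norm]

theorem eLpNorm_two_sq {α E : Type*} [MeasurableSpace α] [NormedAddCommGroup E] (f : α → E)
    (μ : Measure α) : eLpNorm f 2 μ ^ 2 = ∫⁻ x, ‖f x‖ₑ ^ 2 ∂μ := by
  have := eLpNorm_nnreal_pow_eq_lintegral (f := f) (μ := μ) (p := 2) two_ne_zero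
  simpa using this

theorem tsum_enorm_sq_eq {α ι : Type*} [MeasurableSpace α] {μ : Measure α} {g : α → ℂ}
    (hg : MemLp g 2 μ) {c : ι → ℂ} (h : HasSum (fun i => ‖c i‖ ^ 2) (∫ x, ‖g x‖ ^ 2 ∂μ)) :
    ∑' i, ‖c i‖ₑ ^ 2 = eLpNorm g 2 μ ^ 2 := by
  have hint : Integrable (fun x => ‖g x‖ ^ 2) μ := hg.integrable_norm_pow (p := 2) two_ne_zero
  simp only [eLpNorm_two_sq, enorm_sq_eq_ofReal]
  rw [← ofReal_integral_eq_lintegral_ofReal hint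
    (Filter.Eventually.of_forall fun x => by positivity), ← h.tsum_eq,
    ENNReal.ofReal_tsum_of_nonneg (fun _ => by positivity) h.summable]

theorem tsum_fourierCoeff_sq {g : UnitAddCircle → ℂ} (hg : MemLp g 2 circleMeasure) :
    ∑' n, ‖fourierCoeff g n‖ₑ ^ 2 = eLpNorm g 2 circleMeasure ^ 2 := by
  refine tsum_enorm_sq_eq hg ?_
  have h := hasSum_sq_fourierCoeff (hg.toLp g)
  rw [fourierCoeff_congr_ae hg.coeFn_toLp] at h
  convert h using 1
  refine integral_congr_ae ?_
  filter_upwards [hg.coeFn_toLp] with x hx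
  rw [hx]

/-! ## Functions on the circle and their lifts to the real line -/

theorem circleMeasure_eq_volume : circleMeasure = (volume : Measure UnitAddCircle) := by
  simp [AddCircle.volume_eq_smul_haarAddCircle]

theorem measurePreserving_coe_circleMeasure :
    MeasurePreserving ((↑) : ℝ → UnitAddCircle) (volume.restrict (Set.Ioc 0 1)) circleMeasure := by
  have := UnitAddCircle.measurePreserving_mk 0
  rwa [zero_add, ← circleMeasure_eq_volume] at this

theorem memLp_circle_of_comp_coe {F : UnitAddCircle → ℂ}
    (h : MemLp (fun x : ℝ => F x) 2 (volume.restrict (Set.Ioc 0 1))) :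
    MemLp F 2 circleMeasure := by
  have h' : MemLp (fun x : ℝ => F x) 2 (volume.restrict (Set.Ioc 0 (0 + 1))) := by
    rwa [zero_add]
  have h2 := h'.memLp_liftIoc.haarAddCircle
  convert h2
  ext y
  have hy : y ∈ ((↑) : ℝ → UnitAddCircle) '' Set.Ioc 0 (0 + 1) := by
    rw [AddCircle.coe_image_Ioc_eq]
    trivial
  obtain ⟨x, hx, rfl⟩ := hy
  rw [AddCircle.liftIoc_coe_apply hx]

theorem periodize_coe (g : ℝ → ℝ) (x : ℝ) :
    periodize g (x : UnitAddCircle) = ∑' l : ℤ, g (x + l) :=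
  Function.Periodic.lift_coe _ _

section Periodize

variable {g : ℝ → ℝ} {a b : ℝ}

/-- Compact support leaves finitely many translates, with one index set valid on the whole period;
periodization is thus a finite sum there. -/
theorem eq_zero_of_notMem_Icc_translates (hg : ∀ x, x ∉ Set.Icc a b → g x = 0) {x : ℝ}
    (hx : x ∈ Set.Ioc (0 : ℝ) 1) {l : ℤ} (hl : l ∉ Finset.Icc ⌈a - 1⌉ ⌊b⌋) : g (x + l) = 0 := by
  refine hg _ fun h => hl ?_
  rw [Finset.mem_Icc, Int.ceil_le, Int.le_floor]
  exact ⟨by linarith [h.1, hx.2], by linarith [h.2, hx.1]⟩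

theorem periodize_eq_sum (hg : ∀ x, x ∉ Set.Icc a b → g x = 0) {x : ℝ}
    (hx : x ∈ Set.Ioc (0 : ℝ) 1) :
    periodize g (x : UnitAddCircle) = ∑ l ∈ Finset.Icc ⌈a - 1⌉ ⌊b⌋, g (x + l) := by
  rw [periodize_coe]
  exact tsum_eq_sum fun l hl => eq_zero_of_notMem_Icc_translates hg hx hl

theorem memLp_periodize (hg : ∀ x, x ∉ Set.Icc a b → g x = 0) (h2 : MemLp g 2 volume) :
    MemLp (fun x => (periodize g x : ℂ)) 2 circleMeasure := by
  refine memLp_circle_of_comp_coe ?_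
  have h : MemLp (fun x : ℝ => ∑ l ∈ Finset.Icc ⌈a - 1⌉ ⌊b⌋, g (x + l)) 2
      (volume.restrict (Set.Ioc 0 1)) :=
    (memLp_finsetSum _ fun (l : ℤ) _ =>
      h2.comp_measurePreserving (measurePreserving_add_right volume (l : ℝ))).restrict _
  refine (memLp_congr_ae ?_).2 h.ofReal
  filter_upwards [ae_restrict_mem measurableSet_Ioc] with x hx
  rw [periodize_eq_sum hg hx]
  rfl

/-- Unit intervals tile the line, and a character of integer frequency does not see integer shifts.
-/
theorem fourierCoeff_periodize (hg : ∀ x, x ∉ Set.Icc a b → g x = 0) (h1 : Integrable g)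
    (n : ℤ) : fourierCoeff (fun x => (periodize g x : ℂ)) n
      = ∫ t : ℝ, Complex.exp (-(2 * Real.pi * n * t) * Complex.I) * (g t : ℂ) := by
  set F : ℝ → ℂ := fun t => Complex.exp (-(2 * Real.pi * n * t) * Complex.I) * (g t : ℂ) with hF
  have hFint : Integrable F := by
    refine h1.ofReal.bdd_mul (c := 1) (by fun_prop) (Filter.Eventually.of_forall fun t => ?_)
    have := Complex.norm_exp_ofReal_mul_I (-(2 * Real.pi * n * t))
    push_cast at this
    exact this.le
  have hsum := hFint.hasSum_intervalIntegral_comp_add_int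
  have hzero : ∀ l ∉ Finset.Icc ⌈a - 1⌉ ⌊b⌋, ∫ x in (0 : ℝ)..1, F (x + l) = 0 := by
    intro l hl
    rw [intervalIntegral.integral_of_le zero_le_one]
    refine (setIntegral_congr_fun measurableSet_Ioc fun x hx => ?_).trans (integral_zero _ _)
    simp only [hF, eq_zero_of_notMem_Icc_translates hg hx hl, Complex.ofReal_zero, mul_zero]
  rw [fourierCoeff_eq_intervalIntegral _ _ 0, ← hsum.tsum_eq, tsum_eq_sum hzero,
    ← intervalIntegral.integral_finsetSum]
  · simp only [div_one, one_smul, zero_add]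
    rw [intervalIntegral.integral_of_le zero_le_one, intervalIntegral.integral_of_le zero_le_one]
    refine setIntegral_congr_fun measurableSet_Ioc fun x hx => ?_
    simp only [periodize_eq_sum hg hx, hF, smul_eq_mul, Complex.ofReal_sum, Finset.mul_sum,
      fourier_coe_apply]
    refine Finset.sum_congr rfl fun l _ => ?_
    congr 1
    rw [Complex.exp_eq_exp_iff_exists_int]
    exact ⟨n * l, by push_cast; ring⟩
  · intro l _
    exact (hFint.comp_add_right (l : ℝ)).intervalIntegrable

end Periodize

/-! ## Finite exponential sums -/

/-- A geometric sum whose ratio is an N-th root of unity, different from 1 when 0 < |k| < N. The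
starting point is left free so that a window centred at the origin can be used later. -/
theorem sum_exp_int_eq {N : ℕ} (a k : ℤ) (hk : |k| < N) :
    ∑ n ∈ Finset.Ico a (a + N), Complex.exp (-(2 * Real.pi * n * (k / N)) * Complex.I)
      = if k = 0 then (N : ℂ) else 0 := by
  have hN : (N : ℂ) ≠ 0 := by
    rintro h
    have : (N : ℤ) = 0 := by exact_mod_cast h
    have := abs_nonneg k
    omega
  split_ifs with h0
  · simp [h0]
  set ζ : ℂ := Complex.exp (-(2 * Real.pi * (k / N)) * Complex.I) with hζ
  have h1 : ζ ≠ 1 := by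
    rw [hζ, Ne, Complex.exp_eq_one_iff]
    rintro ⟨p, hp⟩
    have h2 : (k : ℂ) = ((-p * N : ℤ) : ℂ) := by
      have hpi : (2 * Real.pi * Complex.I : ℂ) ≠ 0 := Complex.two_pi_I_ne_zero
      have : (2 * Real.pi * Complex.I : ℂ) * (k / N) = (2 * Real.pi * Complex.I) * (-p) := by
        linear_combination -hp
      have := mul_left_cancel₀ hpi this
      field_simp at this
      push_cast
      rw [this]
      ring
    have h3 : k = -p * N := by exact_mod_cast h2
    have hp0 : p ≠ 0 := by
      rintro rfl
      simp at h3
      exact h0 h3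
    rw [h3, abs_mul, abs_neg, Nat.abs_cast] at hk
    have := Int.one_le_abs hp0
    nlinarith
  have hN1 : ζ ^ N = 1 := by
    rw [hζ, ← Complex.exp_nat_mul, Complex.exp_eq_one_iff]
    exact ⟨-k, by field_simp; push_cast; ring⟩
  have hre : ∑ n ∈ Finset.Ico a (a + N), Complex.exp (-(2 * Real.pi * n * (k / N)) * Complex.I)
      = ∑ i ∈ Finset.range N, ζ ^ a * ζ ^ i := by
    symm
    refine Finset.sum_bij (fun i _ => a + (i : ℤ)) ?_ ?_ ?_ ?_
    · intro i hi
      simp at hi ⊢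
      omega
    · intro i _ i' _ h
      simpa using h
    · intro n hn
      simp at hn
      exact ⟨(n - a).toNat, by simp; omega, by omega⟩
    · intro i _
      rw [← zpow_natCast, ← zpow_add₀ (Complex.exp_ne_zero _), ← Complex.exp_int_mul]
      congr 1
      push_cast
      ring
  rw [hre, ← Finset.mul_sum, geom_sum_eq h1, hN1]
  simp

/-- Parseval's identity for the discrete Fourier transform. -/
theorem sum_norm_sq_exp_sum (N : ℕ) (a : ℤ) (z : ℤ → ℂ) :
    ∑ n ∈ Finset.Ico a (a + N), ‖∑ k ∈ Finset.Ico (0 : ℤ) N,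
        z k * Complex.exp (-(2 * Real.pi * n * (k / N)) * Complex.I)‖ₑ ^ 2
      = N * ∑ k ∈ Finset.Ico (0 : ℤ) N, ‖z k‖ₑ ^ 2 := by
  have key : ∑ n ∈ Finset.Ico a (a + N), ‖∑ k ∈ Finset.Ico (0 : ℤ) N,
        z k * Complex.exp (-(2 * Real.pi * n * (k / N)) * Complex.I)‖ ^ 2
      = N * ∑ k ∈ Finset.Ico (0 : ℤ) N, ‖z k‖ ^ 2 := by
    rw [← Complex.ofReal_inj]
    push_cast
    simp_rw [← Complex.mul_conj', map_sum, Finset.sum_mul_sum]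
    rw [Finset.sum_comm, Finset.mul_sum]
    refine Finset.sum_congr rfl fun k hk => ?_
    rw [Finset.sum_comm]
    have : ∀ k' ∈ Finset.Ico (0 : ℤ) N, ∑ n ∈ Finset.Ico a (a + N),
        z k * Complex.exp (-(2 * Real.pi * n * (k / N)) * Complex.I) *
          (starRingEnd ℂ) (z k' * Complex.exp (-(2 * Real.pi * n * (k' / N)) * Complex.I))
        = if k = k' then N * (z k * (starRingEnd ℂ) (z k')) else 0 := by
      intro k' hk'
      have h := sum_exp_int_eq (N := N) a (k - k') (by
        simp only [Finset.mem_Ico] at hk hk'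
        grind)
      simp only [sub_eq_zero] at h
      calc _ = (z k * (starRingEnd ℂ) (z k')) * ∑ n ∈ Finset.Ico a (a + N),
            Complex.exp (-(2 * Real.pi * n * ((k - k' : ℤ) / N)) * Complex.I) := by
            rw [Finset.mul_sum]
            refine Finset.sum_congr rfl fun n _ => ?_
            have hc : (starRingEnd ℂ) (Complex.exp (-(2 * Real.pi * n * (k' / N)) * Complex.I))
                = Complex.exp (2 * Real.pi * n * (k' / N) * Complex.I) := by
              simp [← Complex.exp_conj, map_ofNat]
            have he : Complex.exp (-(2 * Real.pi * n * ((k - k' : ℤ) / N)) * Complex.I)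
                = Complex.exp (-(2 * Real.pi * n * (k / N)) * Complex.I) *
                  Complex.exp (2 * Real.pi * n * (k' / N) * Complex.I) := by
              rw [← Complex.exp_add]
              congr 1
              push_cast
              ring
            rw [map_mul, hc, he]
            ring
        _ = _ := by
            rw [h]
            split_ifs <;> ring
    rw [Finset.sum_congr rfl this, Finset.sum_ite_eq, if_pos hk]
  simp_rw [enorm_sq_eq_ofReal]
  rw [← ENNReal.ofReal_sum_of_nonneg fun _ _ => by positivity, key,
    ENNReal.ofReal_mul (by positivity), ENNReal.ofReal_natCast,
    ENNReal.ofReal_sum_of_nonneg fun _ _ => by positivity]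

/-! ## The Fourier transform of the wavelet near the origin -/

section Wavelet

variable {ψ : ℝ → ℝ} {S : ℝ}

theorem HasSupport.eq_zero (h : HasSupport ψ S) {x : ℝ} (hx : x ∉ Set.Icc 0 S) : ψ x = 0 :=
  image_eq_zero_of_notMem_tsupport (by rwa [h])

theorem HasSupport.integrable (h : HasSupport ψ S) (h2 : MemLp ψ 2 volume) : Integrable ψ := by
  rw [← integrableOn_iff_integrable_of_support_subset (s := Set.Icc 0 S)
    fun x hx => by_contra fun hn => hx (h.eq_zero hn)]
  exact (h2.restrict _).integrable one_le_two

theorem HasSupport.integrable_continuous_mul (h : HasSupport ψ S) (h2 : MemLp ψ 2 volume)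
    {φ : ℝ → ℂ} (hφ : Continuous φ) : Integrable fun t => φ t * (ψ t : ℂ) := by
  rw [← integrableOn_iff_integrable_of_support_subset (s := Set.Icc 0 S)
    fun x hx => by_contra fun hn => hx (by simp [h.eq_zero hn])]
  exact (h.integrable h2).ofReal.integrableOn.continuousOn_mul hφ.continuousOn isCompact_Icc

/-- The Fourier transform of `ψ`. -/
noncomputable def waveletFourier (ψ : ℝ → ℝ) (ξ : ℝ) : ℂ :=
  ∫ t : ℝ, Complex.exp (-(2 * Real.pi * ξ * t) * Complex.I) * (ψ t : ℂ)

/-- By the vanishing moments, the Taylor polynomial of the exponential of degree below m may be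
subtracted under the integral. On [0, S] the remainder is of order |ξ|^m. -/
theorem norm_waveletFourier_le {m : ℕ} (h : HasSupport ψ S) (h2 : MemLp ψ 2 volume)
    (hm : HasVanishingMoments ψ m) {ξ : ℝ} (hξ : |ξ| ≤ 1) :
    ‖waveletFourier ψ ξ‖
      ≤ |ξ| ^ m * ((2 * Real.pi * |S|) ^ m * Real.exp (2 * Real.pi * |S|)) * ∫ t, |ψ t| := by
  set w : ℝ → ℂ := fun t => -(2 * Real.pi * ξ * t) * Complex.I with hw
  have hpoly : ∫ t : ℝ, (∑ β ∈ Finset.range m, w t ^ β / β.factorial) * (ψ t : ℂ) = 0 := by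
    simp_rw [Finset.sum_mul]
    rw [integral_finsetSum]
    · refine Finset.sum_eq_zero fun β hβ => ?_
      have h0 := hm β (Finset.mem_range.1 hβ)
      have h0' : ∫ t : ℝ, ((ψ t * t ^ β : ℝ) : ℂ) = 0 := by
        rw [integral_complex_ofReal, h0, Complex.ofReal_zero]
      calc _ = ∫ t : ℝ, ((-(2 * Real.pi * ξ) * Complex.I) ^ β / β.factorial) *
              ((ψ t * t ^ β : ℝ) : ℂ) := by
            refine integral_congr_ae (Filter.Eventually.of_forall fun t => ?_)
            simp only [hw]
            push_cast
            rw [show (-(2 * Real.pi * ξ * t) * Complex.I : ℂ)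
              = (-(2 * Real.pi * ξ) * Complex.I) * t by ring, mul_pow]
            ring
        _ = 0 := by rw [integral_const_mul, h0', mul_zero]
    · intro β _
      exact h.integrable_continuous_mul h2 (by fun_prop)
  have hexp : Integrable fun t => Complex.exp (w t) * (ψ t : ℂ) :=
    h.integrable_continuous_mul h2 (by fun_prop)
  have hpolyint : Integrable fun t : ℝ =>
      (∑ β ∈ Finset.range m, w t ^ β / β.factorial) * (ψ t : ℂ) :=
    h.integrable_continuous_mul h2 (by fun_prop)
  have heq : waveletFourier ψ ξ = ∫ t : ℝ,
      (Complex.exp (w t) - ∑ β ∈ Finset.range m, w t ^ β / β.factorial) * (ψ t : ℂ) := by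
    simp_rw [sub_mul]
    rw [integral_sub hexp hpolyint, hpoly, sub_zero, waveletFourier]
  rw [heq, ← integral_const_mul]
  refine norm_integral_le_of_norm_le ((h.integrable h2).abs.const_mul _)
    (Filter.Eventually.of_forall fun t => ?_)
  rw [norm_mul, Complex.norm_real, Real.norm_eq_abs]
  by_cases ht : t ∈ Set.Icc 0 S
  · refine mul_le_mul_of_nonneg_right ?_ (abs_nonneg _)
    refine (Complex.norm_exp_sub_sum_le_norm_mul_exp _ _).trans ?_
    have hwn : ‖w t‖ = |ξ| * (2 * Real.pi * |t|) := by
      simp only [hw, norm_mul, norm_neg, Complex.norm_I, Complex.norm_real, Real.norm_eq_abs,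
        abs_of_pos Real.pi_pos, Complex.norm_ofNat]
      ring
    have htS : |t| ≤ |S| := by
      rw [abs_of_nonneg ht.1]
      exact ht.2.trans (le_abs_self S)
    have hb : 2 * Real.pi * |t| ≤ 2 * Real.pi * |S| := by
      have := Real.pi_pos
      gcongr
    have hpos : 0 ≤ 2 * Real.pi * |t| := by positivity
    rw [hwn, mul_pow, mul_assoc]
    refine mul_le_mul_of_nonneg_left (mul_le_mul (pow_le_pow_left₀ hpos hb m)
      (Real.exp_le_exp.2 ?_) (Real.exp_pos _).le (by positivity)) (by positivity)
    calc |ξ| * (2 * Real.pi * |t|) ≤ 1 * (2 * Real.pi * |t|) := by gcongr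
      _ ≤ _ := by rwa [one_mul]
  · simp [h.eq_zero ht]

/-! ## Periodised wavelets -/

theorem dilate_eq_zero (h : HasSupport ψ S) (j : ℕ) (k : ℤ) {x : ℝ}
    (hx : x ∉ Set.Icc ((k : ℝ) / 2 ^ j) ((S + k) / 2 ^ j)) : dilate ψ j k x = 0 := by
  have h2 : (0 : ℝ) < 2 ^ j := by positivity
  rw [dilate, h.eq_zero, mul_zero]
  refine fun hn => hx ?_
  rw [zpow_natCast] at hn
  rw [Set.mem_Icc, div_le_iff₀ h2, le_div_iff₀ h2]
  constructor <;> linarith [hn.1, hn.2]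

theorem dilate_natCast (ψ : ℝ → ℝ) (j : ℕ) (k : ℤ) :
    dilate ψ j k = fun x => (2 : ℝ) ^ ((j : ℝ) / 2) * ψ (2 ^ j * x - k) := by
  ext x
  simp [dilate]

theorem perWavelet_natCast (ψ : ℝ → ℝ) (j : ℕ) (k : ℤ) :
    perWavelet ψ j k = fun x => (periodize (dilate ψ j k) x : ℂ) := by
  ext x
  simp [perWavelet]

theorem perWavelet_of_neg (ψ : ℝ → ℝ) {j : ℤ} (hj : ¬0 ≤ j) (k : ℤ) :
    perWavelet ψ j k = fun _ => 1 := by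
  ext x
  simp [perWavelet, hj]

theorem lintegral_dilate_sq (ψ : ℝ → ℝ) (j : ℕ) (k : ℤ) :
    ∫⁻ x, ‖dilate ψ j k x‖ₑ ^ 2 = ∫⁻ x, ‖ψ x‖ₑ ^ 2 := by
  have h2 : (0 : ℝ) < 2 ^ j := by positivity
  have hne : (2 : ℝ) ^ j ≠ 0 := h2.ne'
  have hmap := Real.smul_map_volume_mul_left hne
  have hemb := (Homeomorph.mulLeft₀ ((2 : ℝ) ^ j) hne).measurableEmbedding
  calc _ = ∫⁻ x, ENNReal.ofReal |(2 : ℝ) ^ j| * ‖ψ (2 ^ j * x - k)‖ₑ ^ 2 := by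
        refine lintegral_congr fun x => ?_
        rw [dilate, enorm_mul, mul_pow, zpow_natCast, Real.enorm_eq_ofReal (by positivity),
          ← ENNReal.ofReal_pow (by positivity), abs_of_pos h2, ← Real.rpow_natCast _ 2,
          ← Real.rpow_mul zero_le_two]
        congr 2
        rw [← Real.rpow_natCast]
        congr 1
        push_cast
        ring
    _ = ENNReal.ofReal |(2 : ℝ) ^ j| * ∫⁻ x, ‖ψ (2 ^ j * x - k)‖ₑ ^ 2 :=
        lintegral_const_mul' _ _ ENNReal.ofReal_ne_top
    _ = ENNReal.ofReal |(2 : ℝ) ^ j| *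
          ∫⁻ y, ‖ψ (y - k)‖ₑ ^ 2 ∂(Measure.map ((2 : ℝ) ^ j * ·) volume) := by
        congr 1
        exact (hemb.lintegral_map fun y => ‖ψ (y - k)‖ₑ ^ 2).symm
    _ = ∫⁻ y, ‖ψ (y - k)‖ₑ ^ 2 := by
        rw [← smul_eq_mul, ← lintegral_smul_measure, hmap]
    _ = _ := lintegral_sub_right_eq_self (fun y => ‖ψ y‖ₑ ^ 2) (k : ℝ)

theorem memLp_dilate (h2 : MemLp ψ 2 volume) (j : ℕ) (k : ℤ) :
    MemLp (dilate ψ j k) 2 volume := by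
  have h2p : (0 : ℝ) < 2 ^ j := by positivity
  have hq : Measure.QuasiMeasurePreserving (fun x : ℝ => (2 : ℝ) ^ j * x - k) volume volume := by
    refine (measurePreserving_sub_right volume (k : ℝ)).quasiMeasurePreserving.comp
      ⟨by fun_prop, ?_⟩
    rw [Real.map_volume_mul_left h2p.ne']
    exact Measure.smul_absolutelyContinuous
  have hm : AEStronglyMeasurable (dilate ψ j k) volume := by
    rw [dilate_natCast]
    exact (h2.1.comp_quasiMeasurePreserving hq).const_mul ((2 : ℝ) ^ ((j : ℝ) / 2))
  refine ⟨hm, ?_⟩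
  have h := h2.2
  refine (ENNReal.pow_lt_top_iff.1 ?_).resolve_right two_ne_zero
  rw [eLpNorm_two_sq, lintegral_dilate_sq, ← eLpNorm_two_sq]
  exact ENNReal.pow_lt_top h

theorem memLp_perWavelet (h : HasSupport ψ S) (h2 : MemLp ψ 2 volume) (j k : ℤ) :
    MemLp (perWavelet ψ j k) 2 circleMeasure := by
  by_cases hj : 0 ≤ j
  · lift j to ℕ using hj
    rw [perWavelet_natCast]
    exact memLp_periodize (fun x hx => dilate_eq_zero h j k hx) (memLp_dilate h2 j k)
  · rw [perWavelet_of_neg ψ hj]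
    exact memLp_const 1

/-- The Riesz constant bounds the norm of the wavelet. -/
theorem lintegral_sq_le (h : HasSupport ψ S) (h2 : MemLp ψ 2 volume) {γ δ : ℝ}
    (hR : IsPeriodicRiesz ψ γ δ) : ∫⁻ x, ‖ψ x‖ₑ ^ 2 ≤ ENNReal.ofReal δ := by
  -- At such a fine level the support of the dilate fits into one period. Its translates do not
  -- overlap there, so the norms on the circle and on the line agree, and (P3) is applied to a
  -- single coefficient 1.
  obtain ⟨j, hj⟩ := pow_unbounded_of_one_lt S (one_lt_two (α := ℝ))
  have h2p : (0 : ℝ) < 2 ^ j := by positivity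
  have h0 : (0 : ℤ) ∈ levelIndex j := by simp [levelIndex]
  have hR' := (hR j (by positivity) (Pi.single 0 1)).2
  have e1 : (fun x => ∑ k ∈ levelIndex j, (Pi.single 0 1 : ℤ → ℂ) k * perWavelet ψ j k x)
      = perWavelet ψ j 0 := by
    ext x
    rw [Finset.sum_eq_single_of_mem 0 h0 fun k _ hk => by simp [hk]]
    simp
  have e2 : ∑ k ∈ levelIndex j, ‖(Pi.single 0 1 : ℤ → ℂ) k‖ₑ ^ 2 = 1 := by
    rw [Finset.sum_eq_single_of_mem 0 h0 fun k _ hk => by simp [hk]]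
    simp
  rw [e1, e2, mul_one, ← eLpNorm_comp_measurePreserving (memLp_perWavelet h h2 j 0).1
    measurePreserving_coe_circleMeasure, eLpNorm_two_sq] at hR'
  refine le_of_eq_of_le ?_ hR'
  have hsupp : ∀ x : ℝ, x ∉ Set.Icc 0 (S / 2 ^ j) → dilate ψ j 0 x = 0 := fun x hx =>
    dilate_eq_zero h j 0 (by simpa using hx)
  have hS : S / 2 ^ j < 1 := by rwa [div_lt_one h2p]
  rw [← lintegral_dilate_sq ψ j 0, ← restrict_Ioo_eq_restrict_Ioc,
    ← lintegral_indicator measurableSet_Ioo]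
  refine lintegral_congr_ae ?_
  -- The endpoint 0 lies in the closed support but not in the open period, so it is discarded as a
  -- null set.
  filter_upwards [Measure.ae_ne volume (0 : ℝ)] with x hx0
  by_cases hx : x ∈ Set.Ioo (0 : ℝ) 1
  · rw [Set.indicator_of_mem hx]
    rw [perWavelet_natCast, Function.comp_apply, periodize_coe, tsum_eq_single 0]
    · simp [enorm_eq_nnnorm]
    · intro l hl
      refine hsupp _ fun hn => ?_
      rcases lt_or_gt_of_ne hl with hl | hl
      · have : (l : ℝ) ≤ -1 := by exact_mod_cast Int.le_sub_one_of_lt hl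
        linarith [hn.1, hx.2]
      · have : (1 : ℝ) ≤ l := by exact_mod_cast hl
        linarith [hn.2, hx.1]
  · rw [Set.indicator_of_notMem hx, hsupp]
    · simp
    · exact fun hn => hx ⟨lt_of_le_of_ne hn.1 hx0.symm, hn.2.trans_lt hS⟩

/-- Integrate |ψ| ≤ 1 + ψ² over the support. This is what keeps the final constant independent of
`ψ` itself. -/
theorem integral_abs_le (h : HasSupport ψ S) (h2 : MemLp ψ 2 volume) {γ δ : ℝ}
    (hR : IsPeriodicRiesz ψ γ δ) : ∫ t, |ψ t| ≤ |S| + |δ| := by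
  have hsq : Integrable fun t => ψ t ^ 2 := h2.integrable_sq
  have hsqle : ∫ t, ψ t ^ 2 ≤ |δ| := by
    have := lintegral_sq_le h h2 hR
    have e : ∀ t, ‖ψ t‖ₑ ^ 2 = ENNReal.ofReal (ψ t ^ 2) := fun t => by
      rw [← sq_abs, ENNReal.ofReal_pow (abs_nonneg _), ← Real.norm_eq_abs, ofReal_norm]
    simp_rw [e] at this
    rw [← ofReal_integral_eq_lintegral_ofReal hsq
      (Filter.Eventually.of_forall fun t => sq_nonneg _)] at this
    have h3 := this.trans (ENNReal.ofReal_le_ofReal (le_abs_self δ))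
    rwa [ENNReal.ofReal_le_ofReal_iff (abs_nonneg _)] at h3
  have hind : Integrable ((Set.Icc 0 S).indicator fun _ => (1 : ℝ)) :=
    (integrable_indicator_iff measurableSet_Icc).2 (integrableOn_const (by simp))
  calc ∫ t, |ψ t| ≤ ∫ t, ((Set.Icc 0 S).indicator (fun _ => (1 : ℝ)) t + ψ t ^ 2) := by
        refine integral_mono (h.integrable h2).abs (hind.add hsq) fun t => ?_
        by_cases ht : t ∈ Set.Icc 0 S
        · simp only [Set.indicator_of_mem ht]
          nlinarith [sq_abs (ψ t), sq_nonneg (|ψ t| - 1)]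
        · simp [h.eq_zero ht, ht]
    _ = (∫ t, (Set.Icc 0 S).indicator (fun _ => (1 : ℝ)) t) + ∫ t, ψ t ^ 2 :=
        integral_add hind hsq
    _ ≤ |S| + |δ| := by
        refine add_le_add ?_ hsqle
        rw [integral_indicator_const _ measurableSet_Icc]
        simp [Real.volume_real_Icc, le_abs_self]

/-- The translation index `k` enters only through a phase, so at a fixed frequency a combination
over `k` becomes a discrete Fourier transform of length 2^j. -/
theorem fourierCoeff_perWavelet (h : HasSupport ψ S) (h2 : MemLp ψ 2 volume) (j : ℕ) (k n : ℤ) :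
    fourierCoeff (perWavelet ψ j k) n = (((2 : ℝ) ^ (-(j : ℝ) / 2) : ℝ) : ℂ) *
      waveletFourier ψ (n / 2 ^ j) *
      Complex.exp (-(2 * Real.pi * n * (k / (2 ^ j : ℕ))) * Complex.I) := by
  have h2p : (0 : ℝ) < 2 ^ j := by positivity
  have hint : Integrable (dilate ψ j k) := by
    rw [dilate_natCast]
    exact (((h.integrable h2).comp_sub_right (k : ℝ)).comp_mul_left' h2p.ne').const_mul _
  rw [perWavelet_natCast, fourierCoeff_periodize (fun x hx => dilate_eq_zero h j k hx) hint]
  set G : ℝ → ℂ := fun t =>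
    Complex.exp (-(2 * Real.pi * n * ((t + k) / 2 ^ j)) * Complex.I) * (ψ t : ℂ) with hG
  calc _ = ∫ t : ℝ, (((2 : ℝ) ^ ((j : ℝ) / 2) : ℝ) : ℂ) * G (2 ^ j * t - k) := by
        refine integral_congr_ae (Filter.Eventually.of_forall fun t => ?_)
        simp only [hG, dilate]
        have : ((2 ^ j * t - k : ℝ) + k : ℂ) / 2 ^ j = t := by
          push_cast
          field_simp
          ring
        rw [this, zpow_natCast]
        push_cast
        ring
    _ = (((2 : ℝ) ^ ((j : ℝ) / 2) : ℝ) : ℂ) * (((2 : ℝ) ^ j)⁻¹ • ∫ t : ℝ, G t) := by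
        rw [integral_const_mul, Measure.integral_comp_mul_left (fun t => G (t - k)),
          integral_sub_right_eq_self, abs_of_pos (inv_pos.2 h2p)]
    _ = (((2 : ℝ) ^ (-(j : ℝ) / 2) : ℝ) : ℂ) * ∫ t : ℝ, G t := by
        rw [Complex.real_smul, ← mul_assoc, ← Complex.ofReal_mul]
        congr 3
        rw [← Real.rpow_natCast, ← Real.rpow_neg zero_le_two, ← Real.rpow_add two_pos]
        congr 1
        ring
    _ = _ := by
        rw [mul_assoc, waveletFourier, ← integral_mul_const]
        congr 2
        ext t
        simp only [hG]
        rw [mul_right_comm (Complex.exp _) ((ψ t : ℝ) : ℂ), ← Complex.exp_add]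
        congr 2
        push_cast
        ring

end Wavelet

/-! ## Weighted energy of the univariate systems -/

theorem memLp_sum_mul {ι : Type*} {p : ι → UnitAddCircle → ℂ} {K : Finset ι}
    (hp : ∀ k ∈ K, MemLp (p k) 2 circleMeasure) (z : ι → ℂ) :
    MemLp (fun x => ∑ k ∈ K, z k * p k x) 2 circleMeasure :=
  memLp_finsetSum _ fun k hk => (hp k hk).const_mul (z k)

theorem fourierCoeff_sum_mul {ι : Type*} {p : ι → UnitAddCircle → ℂ} {K : Finset ι}
    (hp : ∀ k ∈ K, MemLp (p k) 2 circleMeasure) (z : ι → ℂ) (n : ℤ) :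
    fourierCoeff (fun x => ∑ k ∈ K, z k * p k x) n = ∑ k ∈ K, z k * fourierCoeff (p k) n := by
  have e : (fun x => ∑ k ∈ K, z k * p k x) = ∑ k ∈ K, fun x => z k * p k x := by
    ext x
    simp
  rw [e, fourierCoeff.sum _ _ fun k hk => ((hp k hk).integrable one_le_two).const_mul (z k),
    Finset.sum_apply]
  exact Finset.sum_congr rfl fun k _ => fourierCoeff.const_mul _ _ _

section

variable {ψ : ℝ → ℝ} {S γ δ : ℝ} {m : ℕ}

/-- The constant in the decay of the Fourier transform of the wavelet at the origin. -/
noncomputable def decayConst (m : ℕ) (S δ : ℝ) : ℝ :=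
  (2 * Real.pi * |S|) ^ m * Real.exp (2 * Real.pi * |S|) * (|S| + |δ|)

theorem norm_waveletFourier_le_decayConst (h : HasSupport ψ S) (h2 : MemLp ψ 2 volume)
    (hm : HasVanishingMoments ψ m) (hR : IsPeriodicRiesz ψ γ δ) {ξ : ℝ} (hξ : |ξ| ≤ 1) :
    ‖waveletFourier ψ ξ‖ ≤ |ξ| ^ m * decayConst m S δ := by
  refine (norm_waveletFourier_le h h2 hm hξ).trans ?_
  have := Real.pi_pos
  refine (mul_le_mul_of_nonneg_left (integral_abs_le h h2 hR) (by positivity)).trans_eq ?_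
  rw [decayConst, mul_assoc (|ξ| ^ m)]

/-- Here |n| / 2^j ≤ 2^(l-j), so the order-m decay of the squared transform cancels the weight
4^(m(j-l)) exactly. -/
theorem low_frequency_le (h : HasSupport ψ S) (h2 : MemLp ψ 2 volume)
    (hm : HasVanishingMoments ψ m) (hR : IsPeriodicRiesz ψ γ δ) (j : ℕ) {n : ℤ}
    (hn : dyadicLevel n < j) (K : Finset ℤ) (z : ℤ → ℂ) :
    freqWeight m j n * ‖∑ k ∈ K, z k * fourierCoeff (perWavelet ψ j k) n‖ₑ ^ 2
      ≤ ENNReal.ofReal (decayConst m S δ) ^ 2 * (((2 ^ j : ℕ) : ℝ≥0∞)⁻¹ *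
        ‖∑ k ∈ K, z k * Complex.exp (-(2 * Real.pi * n * (k / (2 ^ j : ℕ))) * Complex.I)‖ₑ ^ 2) := by
  set l := dyadicLevel n with hl
  have h2j : (0 : ℝ) < 2 ^ j := by positivity
  have hnl : |(n : ℝ)| ≤ 2 ^ l := by
    have := (natAbs_lt_two_pow_dyadicLevel n).le
    rw [← hl] at this
    rw [← Int.cast_abs, Int.abs_eq_natAbs, Int.cast_natCast]
    exact_mod_cast this
  have hlj : (2 : ℝ) ^ l ≤ 2 ^ j := pow_le_pow_right₀ one_le_two hn.le
  have hξ : |(n : ℝ) / 2 ^ j| ≤ 2 ^ l / 2 ^ j := by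
    rw [abs_div, abs_of_pos h2j]
    gcongr
  have hW := norm_waveletFourier_le_decayConst h h2 hm hR
    (hξ.trans ((div_le_one h2j).2 hlj))
  have hD : 0 ≤ decayConst m S δ := by
    have := Real.pi_pos
    unfold decayConst
    positivity
  have hW' : (2 : ℝ) ^ (m * (j - l)) * ‖waveletFourier ψ (n / 2 ^ j)‖ ≤ decayConst m S δ := by
    calc _ ≤ (2 : ℝ) ^ (m * (j - l)) * ((2 ^ l / 2 ^ j) ^ m * decayConst m S δ) := by
          refine mul_le_mul_of_nonneg_left (hW.trans ?_) (by positivity)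
          gcongr
      _ = decayConst m S δ := by
          have : (2 : ℝ) ^ j = 2 ^ (j - l) * 2 ^ l := by
            rw [← pow_add, Nat.sub_add_cancel hn.le]
          rw [this, ← mul_assoc, mul_comm m, pow_mul, ← mul_pow]
          have h3 : (2 : ℝ) ^ (j - l) * (2 ^ l / (2 ^ (j - l) * 2 ^ l)) = 1 := by
            field_simp
          rw [h3, one_pow, one_mul]
  have hWe : (2 : ℝ≥0∞) ^ (m * (j - l)) * ‖waveletFourier ψ (n / 2 ^ j)‖ₑ
      ≤ ENNReal.ofReal (decayConst m S δ) := by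
    refine le_trans (le_of_eq ?_) (ENNReal.ofReal_le_ofReal hW')
    rw [ENNReal.ofReal_mul (by positivity), ENNReal.ofReal_pow zero_le_two, ofReal_norm,
      ENNReal.ofReal_ofNat]
  have hsum : ∑ k ∈ K, z k * fourierCoeff (perWavelet ψ j k) n
      = (((2 : ℝ) ^ (-(j : ℝ) / 2) : ℝ) : ℂ) * waveletFourier ψ (n / 2 ^ j) *
        ∑ k ∈ K, z k * Complex.exp (-(2 * Real.pi * n * (k / (2 ^ j : ℕ))) * Complex.I) := by
    rw [Finset.mul_sum]
    refine Finset.sum_congr rfl fun k _ => ?_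
    rw [fourierCoeff_perWavelet h h2]
    ring
  have hscale : ‖(((2 : ℝ) ^ (-(j : ℝ) / 2) : ℝ) : ℂ)‖ₑ ^ 2 = ((2 ^ j : ℕ) : ℝ≥0∞)⁻¹ := by
    rw [enorm_sq_eq_ofReal, Complex.norm_real, Real.norm_of_nonneg (by positivity),
      ← Real.rpow_natCast _ 2, ← Real.rpow_mul zero_le_two]
    rw [show -(j : ℝ) / 2 * (2 : ℕ) = -(j : ℝ) by push_cast; ring, Real.rpow_neg zero_le_two,
      Real.rpow_natCast, ENNReal.ofReal_inv_of_pos h2j, ENNReal.ofReal_pow zero_le_two]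
    simp
  have h4 : freqWeight m j n = ((2 : ℝ≥0∞) ^ (m * (j - l))) ^ 2 := by
    rw [freqWeight, Int.toNat_natCast, ← hl, ← pow_mul, mul_comm _ 2, pow_mul 2 2]
    norm_num
  rw [hsum, enorm_mul, enorm_mul, mul_pow, mul_pow, hscale, h4]
  calc _ = ((2 : ℝ≥0∞) ^ (m * (j - l)) * ‖waveletFourier ψ (n / 2 ^ j)‖ₑ) ^ 2 *
        (((2 ^ j : ℕ) : ℝ≥0∞)⁻¹ * ‖∑ k ∈ K, z k *
          Complex.exp (-(2 * Real.pi * n * (k / (2 ^ j : ℕ))) * Complex.I)‖ₑ ^ 2) := by ring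
    _ ≤ _ := by gcongr

/-- Where the weight is 1, the upper Riesz bound and Parseval suffice. The remaining frequencies lie
in a window of 2^j consecutive integers, where the discrete Parseval identity applies. -/
theorem perWavelet_energy_le (h : HasSupport ψ S) (h2 : MemLp ψ 2 volume)
    (hm : HasVanishingMoments ψ m) (hR : IsPeriodicRiesz ψ γ δ) (j : ℕ) (z : ℤ → ℂ) :
    ∑' n, freqWeight m j n *
        ‖∑ k ∈ levelIndex j, z k * fourierCoeff (perWavelet ψ j k) n‖ₑ ^ 2
      ≤ (ENNReal.ofReal δ + ENNReal.ofReal (decayConst m S δ) ^ 2) *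
        ∑ k ∈ levelIndex j, ‖z k‖ₑ ^ 2 := by
  have hp : ∀ k ∈ levelIndex j, MemLp (perWavelet ψ j k) 2 circleMeasure :=
    fun k _ => memLp_perWavelet h h2 j k
  have hK : levelIndex (j : ℤ) = Finset.Ico (0 : ℤ) ((2 ^ j : ℕ) : ℤ) := by simp [levelIndex]
  set T : ℤ → ℝ≥0∞ := fun n =>
    ‖∑ k ∈ levelIndex j, z k * fourierCoeff (perWavelet ψ j k) n‖ₑ ^ 2 with hT
  have hTsum : ∑' n, T n ≤ ENNReal.ofReal δ * ∑ k ∈ levelIndex j, ‖z k‖ₑ ^ 2 := by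
    refine le_of_eq_of_le ?_ (hR j (by positivity) z).2
    rw [← tsum_fourierCoeff_sq (memLp_sum_mul hp z)]
    exact tsum_congr fun n => by rw [fourierCoeff_sum_mul hp]
  -- Centred window: a dyadic level below j forces |n| < 2^(j-1). For j = 0 the halving truncates
  -- and the window is {0}.
  set a : ℤ := -((2 ^ j : ℕ) / 2 : ℕ) with ha
  set F := Finset.Ico a (a + (2 ^ j : ℕ)) with hF
  set U : ℤ → ℝ≥0∞ := fun n => ENNReal.ofReal (decayConst m S δ) ^ 2 * (((2 ^ j : ℕ) : ℝ≥0∞)⁻¹ *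
    ‖∑ k ∈ levelIndex j, z k *
      Complex.exp (-(2 * Real.pi * n * (k / (2 ^ j : ℕ))) * Complex.I)‖ₑ ^ 2) with hU
  have hpt : ∀ n, freqWeight m j n * T n ≤ T n + if n ∈ F then U n else 0 := by
    intro n
    rcases lt_or_ge (dyadicLevel n) j with hl | hl
    · have hn : n ∈ F := by
        have h1 := natAbs_lt_two_pow_dyadicLevel n
        have h3 : 2 ^ (dyadicLevel n + 1) ≤ 2 ^ j := Nat.pow_le_pow_right two_pos hl
        rw [pow_succ] at h3
        rw [hF, Finset.mem_Ico, ha]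
        generalize 2 ^ j = N at *
        generalize 2 ^ dyadicLevel n = L at *
        omega
      rw [if_pos hn]
      exact (low_frequency_le h h2 hm hR j hl _ z).trans le_add_self
    · have : freqWeight m j n = 1 := by
        rw [freqWeight, Int.toNat_natCast, Nat.sub_eq_zero_of_le hl, mul_zero, pow_zero]
      rw [this, one_mul]
      exact le_self_add
  calc _ ≤ ∑' n, (T n + if n ∈ F then U n else 0) := ENNReal.tsum_le_tsum hpt
    _ = ∑' n, T n + ∑ n ∈ F, U n := by
        rw [ENNReal.tsum_add, tsum_eq_sum (s := F) fun n hn => if_neg hn]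
        congr 1
        exact Finset.sum_congr rfl fun n hn => if_pos hn
    _ = ∑' n, T n + ENNReal.ofReal (decayConst m S δ) ^ 2 * ∑ k ∈ levelIndex j, ‖z k‖ₑ ^ 2 := by
        rw [hU, ← Finset.mul_sum, ← Finset.mul_sum, hF, hK, sum_norm_sq_exp_sum, ← mul_assoc
          (((2 ^ j : ℕ) : ℝ≥0∞)⁻¹), ENNReal.inv_mul_cancel (by simp) (by simp), one_mul]
    _ ≤ _ := by
        rw [add_mul]
        gcongr

end

/-! ### Transfer from the wavelets to their duals -/

/-- The coefficients with respect to a Riesz sequence of a combination of the dual functions. -/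
theorem exists_dual_coefficients {p p' : ℤ → UnitAddCircle → ℂ} {K : Finset ℤ} {γ : ℝ}
    (hγ : 0 < γ) (hp : ∀ k, MemLp (p k) 2 circleMeasure)
    (hRiesz : ∀ z : ℤ → ℂ, ENNReal.ofReal γ * ∑ k ∈ K, ‖z k‖ₑ ^ 2
      ≤ eLpNorm (fun x => ∑ k ∈ K, z k * p k x) 2 circleMeasure ^ 2)
    (hspan : ∀ k ∈ K, ∃ c : ℤ → ℂ, p' k =ᵐ[circleMeasure] fun x => ∑ l ∈ K, c l * p l x)
    (hdual : ∀ k ∈ K, ∀ l ∈ K,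
      ∫ x, p l x * (starRingEnd ℂ) (p' k x) ∂circleMeasure = if k = l then 1 else 0)
    (y : ℤ → ℂ) :
    ∃ z : ℤ → ℂ, ∑ k ∈ K, ‖z k‖ₑ ^ 2 ≤ ENNReal.ofReal (γ ^ 2)⁻¹ * ∑ k ∈ K, ‖y k‖ₑ ^ 2 ∧
      ∀ n, ∑ k ∈ K, y k * fourierCoeff (p' k) n = ∑ k ∈ K, z k * fourierCoeff (p k) n := by
  choose! c hc using hspan
  have hp' : ∀ k ∈ K, MemLp (p' k) 2 circleMeasure := fun k hk =>
    (memLp_congr_ae (hc k hk)).2 (memLp_sum_mul (fun l _ => hp l) _)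
  set z : ℤ → ℂ := fun l => ∑ k ∈ K, y k * c k l with hz
  set g : UnitAddCircle → ℂ := fun x => ∑ l ∈ K, z l * p l x with hg
  have hgL : MemLp g 2 circleMeasure := memLp_sum_mul (fun l _ => hp l) z
  have hg' : g =ᵐ[circleMeasure] fun x => ∑ k ∈ K, y k * p' k x := by
    have : ∀ᵐ x ∂circleMeasure, ∀ k ∈ K, p' k x = ∑ l ∈ K, c k l * p l x :=
      (ae_ball_iff K.countable_toSet).2 hc
    filter_upwards [this] with x hx
    rw [Finset.sum_congr rfl fun k hk => by rw [hx k hk, Finset.mul_sum], Finset.sum_comm]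
    refine Finset.sum_congr rfl fun l _ => ?_
    rw [hz, Finset.sum_mul]
    exact Finset.sum_congr rfl fun k _ => by ring
  refine ⟨z, ?_, fun n => ?_⟩
  · have hint : ∀ k ∈ K, ∀ l ∈ K,
        Integrable (fun x => p l x * (starRingEnd ℂ) (p' k x)) circleMeasure := fun k hk l _ =>
      (hp l).integrable_mul ((hp' k hk).star)
    -- One factor of |g|² is expanded in the primal functions and the other in the dual ones;
    -- biorthogonality leaves the diagonal.
    have hG : ((∫ x, ‖g x‖ ^ 2 ∂circleMeasure : ℝ) : ℂ) = ∑ k ∈ K, z k * (starRingEnd ℂ) (y k) := by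
      rw [← integral_complex_ofReal]
      calc _ = ∫ x, ∑ k ∈ K, ∑ l ∈ K, (z l * (starRingEnd ℂ) (y k)) *
            (p l x * (starRingEnd ℂ) (p' k x)) ∂circleMeasure := by
            refine integral_congr_ae ?_
            filter_upwards [hg'] with x hx
            push_cast
            rw [← Complex.mul_conj']
            nth_rewrite 2 [hx]
            rw [hg, map_sum, Finset.sum_mul_sum, Finset.sum_comm]
            refine Finset.sum_congr rfl fun k _ => Finset.sum_congr rfl fun l _ => ?_
            rw [map_mul]
            ring
        _ = ∑ k ∈ K, ∑ l ∈ K, (z l * (starRingEnd ℂ) (y k)) * if k = l then 1 else 0 := by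
            rw [integral_finsetSum _ fun k hk => integrable_finsetSum _ fun l hl =>
              (hint k hk l hl).const_mul _]
            refine Finset.sum_congr rfl fun k hk => ?_
            rw [integral_finsetSum _ fun l hl => (hint k hk l hl).const_mul _]
            refine Finset.sum_congr rfl fun l hl => ?_
            rw [integral_const_mul, hdual k hk l hl]
        _ = _ := by
            refine Finset.sum_congr rfl fun k hk => ?_
            simp [hk]
    have hsq : ∀ u : ℤ → ℂ, ∑ k ∈ K, ‖u k‖ₑ ^ 2 = ENNReal.ofReal (∑ k ∈ K, ‖u k‖ ^ 2) := by
      intro u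
      simp_rw [enorm_sq_eq_ofReal]
      rw [ENNReal.ofReal_sum_of_nonneg fun _ _ => by positivity]
    have hlow : γ * ∑ k ∈ K, ‖z k‖ ^ 2 ≤ ∫ x, ‖g x‖ ^ 2 ∂circleMeasure := by
      have h := hRiesz z
      have hi : Integrable (fun x => ‖g x‖ ^ 2) circleMeasure :=
        hgL.integrable_norm_pow (p := 2) two_ne_zero
      rw [eLpNorm_two_sq, hsq, ← ENNReal.ofReal_mul hγ.le] at h
      simp_rw [enorm_sq_eq_ofReal] at h
      rw [← ofReal_integral_eq_lintegral_ofReal hi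
        (Filter.Eventually.of_forall fun x => by positivity)] at h
      exact (ENNReal.ofReal_le_ofReal_iff (integral_nonneg fun x => by positivity)).1 h
    have hup : ∫ x, ‖g x‖ ^ 2 ∂circleMeasure ≤ ∑ k ∈ K, ‖z k‖ * ‖y k‖ := by
      have h1 : ‖((∫ x, ‖g x‖ ^ 2 ∂circleMeasure : ℝ) : ℂ)‖ ≤ ∑ k ∈ K, ‖z k‖ * ‖y k‖ := by
        rw [hG]
        refine (norm_sum_le _ _).trans (le_of_eq (Finset.sum_congr rfl fun k _ => ?_))
        rw [norm_mul, RCLike.norm_conj]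
      rw [Complex.norm_real] at h1
      exact (le_abs_self _).trans h1
    -- Young's inequality scaled by γ, so that half of the lower Riesz bound absorbs the z-part.
    have hyoung : ∑ k ∈ K, ‖z k‖ * ‖y k‖
        ≤ γ / 2 * ∑ k ∈ K, ‖z k‖ ^ 2 + (2 * γ)⁻¹ * ∑ k ∈ K, ‖y k‖ ^ 2 := by
      rw [Finset.mul_sum, Finset.mul_sum, ← Finset.sum_add_distrib]
      refine Finset.sum_le_sum fun k _ => ?_
      have : γ / 2 * ‖z k‖ ^ 2 + (2 * γ)⁻¹ * ‖y k‖ ^ 2 - ‖z k‖ * ‖y k‖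
          = (2 * γ)⁻¹ * (γ * ‖z k‖ - ‖y k‖) ^ 2 := by
        field_simp
        ring
      have h0 : 0 ≤ (2 * γ)⁻¹ * (γ * ‖z k‖ - ‖y k‖) ^ 2 := by positivity
      linarith
    rw [hsq, hsq, ← ENNReal.ofReal_mul (by positivity)]
    refine ENNReal.ofReal_le_ofReal ?_
    have hfin : γ / 2 * ∑ k ∈ K, ‖z k‖ ^ 2 ≤ (2 * γ)⁻¹ * ∑ k ∈ K, ‖y k‖ ^ 2 := by linarith
    have h3 := mul_le_mul_of_nonneg_left hfin (by positivity : 0 ≤ 2 / γ)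
    have e1 : 2 / γ * (γ / 2 * ∑ k ∈ K, ‖z k‖ ^ 2) = ∑ k ∈ K, ‖z k‖ ^ 2 := by field_simp
    have e2 : 2 / γ * ((2 * γ)⁻¹ * ∑ k ∈ K, ‖y k‖ ^ 2) = (γ ^ 2)⁻¹ * ∑ k ∈ K, ‖y k‖ ^ 2 := by
      field_simp
    rwa [e1, e2] at h3
  · rw [← fourierCoeff_sum_mul hp', ← fourierCoeff_sum_mul fun l _ => hp l]
    exact (congr_fun (fourierCoeff_congr_ae hg') n).symm

section

variable {ψ : ℝ → ℝ} {S γ δ : ℝ} {m : ℕ} {ψ' : ℤ → ℤ → UnitAddCircle → ℂ}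

/-- The constant in the weighted energy estimate for the univariate dual wavelets. -/
noncomputable def dualConst (m : ℕ) (S γ δ : ℝ) : ℝ≥0∞ :=
  1 + (ENNReal.ofReal δ + ENNReal.ofReal (decayConst m S δ) ^ 2) * ENNReal.ofReal (γ ^ 2)⁻¹

theorem dualConst_ne_top (m : ℕ) (S γ δ : ℝ) : dualConst m S γ δ ≠ ⊤ := by
  unfold dualConst
  finiteness

theorem memLp_dual (h : HasSupport ψ S) (h2 : MemLp ψ 2 volume) (hd : IsDual ψ ψ') {j k : ℤ}
    (hj : -1 ≤ j) (hk : k ∈ levelIndex j) : MemLp (ψ' j k) 2 circleMeasure := by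
  obtain ⟨⟨c, hc⟩, -⟩ := hd j hj k hk
  exact (memLp_congr_ae hc).2 (memLp_sum_mul (fun l _ => memLp_perWavelet h h2 j l) _)

theorem dual_energy_le (hγ : 0 < γ) (h : HasSupport ψ S) (h2 : MemLp ψ 2 volume)
    (hm : HasVanishingMoments ψ m) (hR : IsPeriodicRiesz ψ γ δ) (hd : IsDual ψ ψ') {j : ℤ}
    (hj : -1 ≤ j) (y : ℤ → ℂ) :
    ∑' n, freqWeight m j n * ‖∑ k ∈ levelIndex j, y k * fourierCoeff (ψ' j k) n‖ₑ ^ 2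
      ≤ dualConst m S γ δ * ∑ k ∈ levelIndex j, ‖y k‖ₑ ^ 2 := by
  have hp : ∀ k, MemLp (perWavelet ψ j k) 2 circleMeasure := fun k => memLp_perWavelet h h2 j k
  by_cases hj0 : 0 ≤ j
  · obtain ⟨z, hz, hzy⟩ := exists_dual_coefficients hγ hp (fun z => (hR j hj0 z).1)
      (fun k hk => (hd j hj k hk).1) (fun k hk => (hd j hj k hk).2) y
    simp_rw [hzy]
    lift j to ℕ using hj0
    refine (perWavelet_energy_le h h2 hm hR j z).trans ?_
    refine (mul_le_mul_right hz _).trans ?_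
    rw [dualConst, ← mul_assoc, add_mul 1]
    exact le_add_self
  -- Level -1 consists of the constant function 1: the Riesz constant is 1, the weight is 1, and the
  -- summand 1 in `dualConst` covers this case.
  · have hconst : ∀ z : ℤ → ℂ, eLpNorm (fun x => ∑ k ∈ levelIndex j, z k * perWavelet ψ j k x) 2
        circleMeasure ^ 2 = ∑ k ∈ levelIndex j, ‖z k‖ₑ ^ 2 := by
      intro z
      simp [levelIndex, perWavelet, hj0, eLpNorm_two_sq]
    obtain ⟨z, hz, hzy⟩ := exists_dual_coefficients one_pos hp
      (fun z => by rw [hconst, ENNReal.ofReal_one, one_mul])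
      (fun k hk => (hd j hj k hk).1) (fun k hk => (hd j hj k hk).2) y
    have hw : ∀ n, freqWeight m j n = 1 := fun n => by
      rw [freqWeight, Int.toNat_of_nonpos (by omega), Nat.zero_sub, mul_zero, pow_zero]
    simp_rw [hzy, hw, one_mul]
    have e := tsum_fourierCoeff_sq (memLp_sum_mul (K := levelIndex j) (fun k _ => hp k) z)
    simp_rw [fourierCoeff_sum_mul (fun k (_ : k ∈ levelIndex j) => hp k)] at e
    rw [e, hconst]
    refine hz.trans ?_
    simp only [one_pow, inv_one, ENNReal.ofReal_one]
    gcongr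
    exact le_self_add

end

open UnitAddTorus

/-! ## Fourier coefficients on the torus -/

section Torus

variable {d : ℕ}

theorem mFourierCoeff_eq_integral_torusMeasure (f : UnitAddTorus (Fin d) → ℂ) (n : Fin d → ℤ) :
    mFourierCoeff f n = ∫ x, mFourier (-n) x * f x ∂(torusMeasure d) := rfl

theorem mFourierCoeff_congr_ae {f g : UnitAddTorus (Fin d) → ℂ} (h : f =ᵐ[torusMeasure d] g) :
    mFourierCoeff f = mFourierCoeff g := by
  ext n
  rw [mFourierCoeff_eq_integral_torusMeasure, mFourierCoeff_eq_integral_torusMeasure]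
  refine integral_congr_ae ?_
  filter_upwards [h] with x hx
  rw [hx]

theorem hasSum_mFourierCoeff_mul {f g : UnitAddTorus (Fin d) → ℂ}
    (hf : MemLp f 2 (torusMeasure d)) (hg : MemLp g 2 (torusMeasure d)) :
    HasSum (fun n => (starRingEnd ℂ) (mFourierCoeff g n) * mFourierCoeff f n) (innerL2 f g) := by
  have h := hasSum_prod_mFourierCoeff (hg.toLp g) (hf.toLp f)
  rw [mFourierCoeff_congr_ae hg.coeFn_toLp, mFourierCoeff_congr_ae hf.coeFn_toLp] at h
  convert h using 1
  refine integral_congr_ae ?_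
  filter_upwards [hg.coeFn_toLp, hf.coeFn_toLp] with x hx hx'
  rw [hx, hx', mul_comm]

theorem tsum_mFourierCoeff_sq {g : UnitAddTorus (Fin d) → ℂ} (hg : MemLp g 2 (torusMeasure d)) :
    ∑' n, ‖mFourierCoeff g n‖ₑ ^ 2 = eLpNorm g 2 (torusMeasure d) ^ 2 := by
  refine tsum_enorm_sq_eq hg ?_
  have h := hasSum_sq_mFourierCoeff (hg.toLp g)
  rw [mFourierCoeff_congr_ae hg.coeFn_toLp] at h
  convert h using 1
  refine integral_congr_ae ?_
  filter_upwards [hg.coeFn_toLp] with x hx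
  rw [hx]

theorem integrable_mFourier_mul {f : UnitAddTorus (Fin d) → ℂ}
    (hf : Integrable f (torusMeasure d)) (n : Fin d → ℤ) :
    Integrable (fun x => mFourier n x * f x) (torusMeasure d) := by
  refine hf.bdd_mul (c := 1) (map_continuous (mFourier n)).aestronglyMeasurable
    (Filter.Eventually.of_forall fun x => ?_)
  exact ((mFourier n).norm_coe_le_norm x).trans_eq mFourier_norm

theorem mFourierCoeff_sum_mul {ι : Type*} {K : Finset ι} {F : ι → UnitAddTorus (Fin d) → ℂ}
    (hF : ∀ k ∈ K, Integrable (F k) (torusMeasure d)) (a : ι → ℂ) (n : Fin d → ℤ) :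
    mFourierCoeff (fun x => ∑ k ∈ K, a k * F k x) n = ∑ k ∈ K, a k * mFourierCoeff (F k) n := by
  simp_rw [mFourierCoeff_eq_integral_torusMeasure, Finset.mul_sum, ← integral_const_mul]
  rw [integral_finsetSum]
  · refine Finset.sum_congr rfl fun k _ => integral_congr_ae ?_
    exact Filter.Eventually.of_forall fun x => by ring
  · intro k hk
    refine ((integrable_mFourier_mul (hF k hk) (-n)).const_mul (a k)).congr ?_
    exact Filter.Eventually.of_forall fun x => by ring

theorem mFourierCoeff_prod (F : Fin d → UnitAddCircle → ℂ) (n : Fin d → ℤ) :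
    mFourierCoeff (fun x => ∏ i, F i (x i)) n = ∏ i, fourierCoeff (F i) (n i) := by
  rw [mFourierCoeff_eq_integral_torusMeasure]
  simp only [fourierCoeff, smul_eq_mul]
  rw [← integral_fintype_prod_eq_prod]
  refine integral_congr_ae (Filter.Eventually.of_forall fun x => ?_)
  simp only [mFourier, ContinuousMap.coe_mk, Pi.neg_apply, Finset.prod_mul_distrib]

theorem memLp_prod {F : Fin d → UnitAddCircle → ℂ} (hF : ∀ i, MemLp (F i) 2 circleMeasure) :
    MemLp (fun x : UnitAddTorus (Fin d) => ∏ i, F i (x i)) 2 (torusMeasure d) := by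
  have h1 : Integrable (fun x : UnitAddTorus (Fin d) => ∏ i, F i (x i)) (torusMeasure d) :=
    Integrable.fintype_prod fun i => (hF i).integrable one_le_two
  rw [memLp_two_iff_integrable_sq_norm h1.1]
  simp_rw [norm_prod, ← Finset.prod_pow]
  exact Integrable.fintype_prod (f := fun i x => ‖F i x‖ ^ 2)
    fun i => (hF i).integrable_norm_pow (p := 2) two_ne_zero

/-! ## The energy of a level in terms of Fourier coefficients -/

theorem two_mul_le_weighted {t x y : ℝ≥0∞} (ht0 : t ≠ 0) (ht : t ≠ ⊤) (hx : x ≠ ⊤) (hy : y ≠ ⊤) :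
    2 * (x * y) ≤ t * x ^ 2 + t⁻¹ * y ^ 2 := by
  lift t to ℝ≥0 using ht
  lift x to ℝ≥0 using hx
  lift y to ℝ≥0 using hy
  have ht0' : t ≠ 0 := by exact_mod_cast ht0
  rw [← ENNReal.coe_inv ht0']
  norm_cast
  rw [← NNReal.coe_le_coe]
  push_cast
  have hpos : (0 : ℝ) < t := NNReal.coe_pos.2 (pos_iff_ne_zero.2 ht0')
  have : (t : ℝ) * x ^ 2 + (t : ℝ)⁻¹ * y ^ 2 - 2 * (x * y) = (t : ℝ)⁻¹ * (t * x - y) ^ 2 := by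
    field_simp
    ring
  have h0 : 0 ≤ (t : ℝ)⁻¹ * (t * x - y) ^ 2 := by positivity
  linarith

/-- Duality: for the combination `G` with coefficients ⟨f, η_{j,k}⟩, the pairing of `f` with `G`
equals the level energy. Parseval and a weighted Young inequality bound twice the energy by the
energy plus the claimed right-hand side. -/
theorem levelEnergy_le_of_energy_le {η : ℤ → ℤ → UnitAddCircle → ℂ} {A : ℝ≥0∞} (hA0 : A ≠ 0)
    (hA : A ≠ ⊤) (j : Fin d → ℤ) (v : Fin d → ℤ → ℝ≥0∞) (hv0 : ∀ i n, v i n ≠ 0)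
    (hv : ∀ i n, v i n ≠ ⊤)
    (hη : ∀ i, ∀ k ∈ levelIndex (j i), MemLp (η (j i) k) 2 circleMeasure)
    (henergy : ∀ i, ∀ y : ℤ → ℂ, ∑' n, v i n *
      ‖∑ k ∈ levelIndex (j i), y k * fourierCoeff (η (j i) k) n‖ₑ ^ 2
        ≤ A * ∑ k ∈ levelIndex (j i), ‖y k‖ₑ ^ 2)
    {f : UnitAddTorus (Fin d) → ℂ} (hf : MemLp f 2 (torusMeasure d)) :
    levelEnergy η f j ≤ A ^ d * ∑' n, (∏ i, v i (n i))⁻¹ * ‖mFourierCoeff f n‖ₑ ^ 2 := by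
  set a : (Fin d → ℤ) → ℂ := fun k => innerL2 f (tensor η j k) with ha
  set G : UnitAddTorus (Fin d) → ℂ := fun x => ∑ k ∈ multiIndex j, a k * tensor η j k x with hG
  set V : (Fin d → ℤ) → ℝ≥0∞ := fun n => ∏ i, v i (n i) with hV
  have hV0 : ∀ n, V n ≠ 0 := fun n => Finset.prod_ne_zero_iff.2 fun i _ => hv0 i _
  have hVt : ∀ n, V n ≠ ⊤ := fun n => ENNReal.prod_ne_top fun i _ => hv i _
  have hB0 : A ^ d ≠ 0 := pow_ne_zero _ hA0
  have hBt : A ^ d ≠ ⊤ := ENNReal.pow_ne_top hA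
  have htens : ∀ k ∈ multiIndex j, MemLp (tensor η j k) 2 (torusMeasure d) := fun k hk =>
    memLp_prod fun i => hη i (k i) (Fintype.mem_piFinset.1 hk i)
  have hGL : MemLp G 2 (torusMeasure d) :=
    memLp_finsetSum _ fun k hk => (htens k hk).const_mul (a k)
  have hGcoeff : ∀ n, mFourierCoeff G n
      = ∑ k ∈ multiIndex j, a k * ∏ i, fourierCoeff (η (j i) (k i)) (n i) := by
    intro n
    rw [hG, mFourierCoeff_sum_mul fun k hk => (htens k hk).integrable one_le_two]
    exact Finset.sum_congr rfl fun k _ => by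
      rw [← mFourierCoeff_prod fun i => η (j i) (k i)]
      rfl
  have hGenergy : ∑' n, V n * ‖mFourierCoeff G n‖ₑ ^ 2 ≤ A ^ d * levelEnergy η f j := by
    simp_rw [hGcoeff]
    exact tensor_energy_le (fun i => levelIndex (j i)) (fun i k n => fourierCoeff (η (j i) k) n)
      v henergy a
  have hinner : ‖innerL2 f G‖ₑ = levelEnergy η f j := by
    have h1 : innerL2 f G = ∑ k ∈ multiIndex j, (starRingEnd ℂ) (a k) * a k := by
      simp only [innerL2, hG, map_sum, map_mul, Finset.mul_sum]
      rw [integral_finsetSum]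
      · refine Finset.sum_congr rfl fun k _ => ?_
        change _ = (starRingEnd ℂ) (a k) *
          ∫ x, f x * (starRingEnd ℂ) (tensor η j k x) ∂(torusMeasure d)
        rw [← integral_const_mul]
        exact integral_congr_ae (Filter.Eventually.of_forall fun x => by ring)
      · intro k hk
        refine ((hf.integrable_mul (htens k hk).star).const_mul ((starRingEnd ℂ) (a k))).congr ?_
        exact Filter.Eventually.of_forall fun x => by
          simp only [Pi.mul_apply, Pi.star_apply, RCLike.star_def]
          ring
    have h2 : innerL2 f G = ((∑ k ∈ multiIndex j, ‖a k‖ ^ 2 : ℝ) : ℂ) := by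
      rw [h1]
      push_cast
      exact Finset.sum_congr rfl fun k _ => Complex.conj_mul' _
    rw [h2, ← ofReal_norm, Complex.norm_real, Real.norm_of_nonneg (by positivity),
      ENNReal.ofReal_sum_of_nonneg fun _ _ => by positivity]
    exact Finset.sum_congr rfl fun k _ => (enorm_sq_eq_ofReal _).symm
  -- Finiteness is needed to cancel the energy from both sides at the end.
  have hfin : levelEnergy η f j ≠ ⊤ := hinner ▸ enorm_ne_top
  have hle : levelEnergy η f j ≤ ∑' n, ‖mFourierCoeff G n‖ₑ * ‖mFourierCoeff f n‖ₑ := by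
    rw [← hinner, ← (hasSum_mFourierCoeff_mul hf hGL).tsum_eq]
    refine (enorm_tsum_le_tsum_enorm).trans (le_of_eq (tsum_congr fun n => ?_))
    rw [enorm_mul, RCLike.enorm_conj]
  have h2le : 2 * levelEnergy η f j ≤ levelEnergy η f j +
      A ^ d * ∑' n, (V n)⁻¹ * ‖mFourierCoeff f n‖ₑ ^ 2 := by
    calc 2 * levelEnergy η f j
        ≤ ∑' n, 2 * (‖mFourierCoeff G n‖ₑ * ‖mFourierCoeff f n‖ₑ) := by
          rw [ENNReal.tsum_mul_left]
          gcongr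
      -- The Young parameter V/A^d is chosen so that the `G`-part contributes at most one copy of
      -- the energy.
      _ ≤ ∑' n, (((A ^ d)⁻¹ * V n) * ‖mFourierCoeff G n‖ₑ ^ 2 +
            ((A ^ d)⁻¹ * V n)⁻¹ * ‖mFourierCoeff f n‖ₑ ^ 2) :=
          ENNReal.tsum_le_tsum fun n => two_mul_le_weighted
            (mul_ne_zero (ENNReal.inv_ne_zero.2 hBt) (hV0 n))
            (ENNReal.mul_ne_top (ENNReal.inv_ne_top.2 hB0) (hVt n)) enorm_ne_top enorm_ne_top
      _ = (A ^ d)⁻¹ * ∑' n, V n * ‖mFourierCoeff G n‖ₑ ^ 2 +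
            A ^ d * ∑' n, (V n)⁻¹ * ‖mFourierCoeff f n‖ₑ ^ 2 := by
          rw [ENNReal.tsum_add, ← ENNReal.tsum_mul_left, ← ENNReal.tsum_mul_left]
          congr 1
          · exact tsum_congr fun n => by ring
          · refine tsum_congr fun n => ?_
            rw [ENNReal.mul_inv (.inr (hVt n)) (.inr (hV0 n)), inv_inv, mul_assoc]
      _ ≤ (A ^ d)⁻¹ * (A ^ d * levelEnergy η f j) + _ := by gcongr
      _ = _ := by rw [← mul_assoc, ENNReal.inv_mul_cancel hB0 hBt, one_mul]
  rw [two_mul] at h2le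
  exact (ENNReal.add_le_add_iff_left hfin).1 h2le

/-! ## Mixed differences on the Fourier side -/

theorem mFourier_add_apply (n : Fin d → ℤ) (x y : UnitAddTorus (Fin d)) :
    mFourier n (x + y) = mFourier n x * mFourier n y := by
  simp [mFourier, ← Finset.prod_mul_distrib, fourier_apply, smul_add, AddCircle.toCircle_add]

theorem mFourier_single_apply (n : Fin d → ℤ) (i : Fin d) (c : UnitAddCircle) :
    mFourier n (Pi.single i c) = fourier (n i) c := by
  simp only [mFourier, ContinuousMap.coe_mk]
  rw [Finset.prod_eq_single i]
  · simp
  · intro k _ hk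
    rw [Pi.single_eq_of_ne hk, fourier_eval_zero]
  · simp

theorem measurePreserving_add_torus (a : UnitAddTorus (Fin d)) :
    MeasurePreserving (fun x => x + a) (torusMeasure d) (torusMeasure d) :=
  measurePreserving_add_right _ a

theorem mFourierCoeff_translate (f : UnitAddTorus (Fin d) → ℂ) (a : UnitAddTorus (Fin d))
    (n : Fin d → ℤ) :
    mFourierCoeff (fun x => f (x + a)) n = mFourier n a * mFourierCoeff f n := by
  simp only [mFourierCoeff_eq_integral_torusMeasure, ← integral_const_mul]
  rw [← integral_add_right_eq_self (fun x => mFourier n a * (mFourier (-n) x * f x)) a]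
  refine integral_congr_ae (Filter.Eventually.of_forall fun x => ?_)
  have h : mFourier n a * mFourier (-n) a = 1 := by
    rw [← mFourier_add, add_neg_cancel, mFourier_zero]
    rfl
  simp only [mFourier_add_apply]
  linear_combination (-(mFourier (-n) x * f (x + a))) * h

variable {r : ℕ} {f : UnitAddTorus (Fin d) → ℂ}

theorem memLp_translate (hf : MemLp f 2 (torusMeasure d)) (a : UnitAddTorus (Fin d)) :
    MemLp (fun x => f (x + a)) 2 (torusMeasure d) :=
  hf.comp_measurePreserving (measurePreserving_add_torus a)

theorem memLp_coordDiff (hf : MemLp f 2 (torusMeasure d)) (i : Fin d) (h : ℝ) :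
    MemLp (coordDiff r i h f) 2 (torusMeasure d) :=
  memLp_finsetSum _ fun _ _ => (memLp_translate hf _).const_mul _

theorem mFourierCoeff_coordDiff (hf : MemLp f 2 (torusMeasure d)) (i : Fin d) (h : ℝ)
    (n : Fin d → ℤ) :
    mFourierCoeff (coordDiff r i h f) n
      = (fourier (n i) (h : UnitAddCircle) - 1) ^ r * mFourierCoeff f n := by
  unfold coordDiff
  rw [mFourierCoeff_sum_mul fun _ _ => (memLp_translate hf _).integrable one_le_two,
    sub_eq_add_neg, add_pow, Finset.sum_mul]
  refine Finset.sum_congr rfl fun q _ => ?_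
  rw [mFourierCoeff_translate, mFourier_single_apply]
  have : (fourier (n i) (((q : ℝ) * h : ℝ) : UnitAddCircle) : ℂ)
      = (fourier (n i) (h : UnitAddCircle) : ℂ) ^ q := by
    rw [fourier_coe_apply, fourier_coe_apply, ← Complex.exp_nat_mul]
    congr 1
    push_cast
    ring
  rw [this]
  ring

theorem foldr_coordDiff (hf : MemLp f 2 (torusMeasure d)) (L : List (Fin d)) (h : Fin d → ℝ) :
    MemLp (L.foldr (fun i g => coordDiff r i (h i) g) f) 2 (torusMeasure d) ∧
      ∀ n, mFourierCoeff (L.foldr (fun i g => coordDiff r i (h i) g) f) n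
        = (L.map fun i => (fourier (n i) (h i : UnitAddCircle) - 1 : ℂ) ^ r).prod *
          mFourierCoeff f n := by
  induction L with
  | nil => exact ⟨hf, fun n => by simp⟩
  | cons i L ih =>
    refine ⟨memLp_coordDiff ih.1 i (h i), fun n => ?_⟩
    rw [List.foldr_cons, mFourierCoeff_coordDiff ih.1, ih.2, List.map_cons, List.prod_cons,
      mul_assoc]

theorem memLp_mixedDiff (hf : MemLp f 2 (torusMeasure d)) (u : Finset (Fin d)) (h : Fin d → ℝ) :
    MemLp (mixedDiff r u h f) 2 (torusMeasure d) :=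
  (foldr_coordDiff hf _ h).1

theorem mFourierCoeff_mixedDiff (hf : MemLp f 2 (torusMeasure d)) (u : Finset (Fin d))
    (h : Fin d → ℝ) (n : Fin d → ℤ) :
    mFourierCoeff (mixedDiff r u h f) n
      = (∏ i ∈ u, (fourier (n i) (h i : UnitAddCircle) - 1 : ℂ) ^ r) * mFourierCoeff f n := by
  rw [mixedDiff, (foldr_coordDiff hf _ h).2]
  congr 1
  rw [← List.prod_toFinset _ (u.sort_nodup _), Finset.sort_toFinset]

/-- The symbol of a difference is bounded from below on the dyadic block fitting to the step. -/
theorem one_le_norm_fourier_sub_one {n : ℤ} (hn : dyadicLevel n ≠ 0) :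
    1 ≤ ‖(fourier n (((2 ^ (dyadicLevel n + 1))⁻¹ : ℝ) : UnitAddCircle) - 1 : ℂ)‖ := by
  set l := dyadicLevel n with hl
  set θ : ℝ := 2 * Real.pi * n * (2 ^ (l + 1))⁻¹ with hθ
  have e : (fourier n (((2 ^ (l + 1))⁻¹ : ℝ) : UnitAddCircle) : ℂ)
      = Complex.exp (θ * Complex.I) := by
    rw [fourier_coe_apply, hθ]
    congr 1
    push_cast
    ring
  have h1 := natAbs_lt_two_pow_dyadicLevel n
  have h2 := two_pow_le_two_mul_natAbs hn
  rw [← hl] at h1 h2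
  have habs : (n.natAbs : ℝ) = |(n : ℝ)| := by
    rw [← Int.cast_abs, Int.abs_eq_natAbs, Int.cast_natCast]
  have h1' : |(n : ℝ)| ≤ 2 ^ l := by
    rw [← habs]
    exact_mod_cast h1.le
  have h2' : (2 : ℝ) ^ l ≤ 2 * |(n : ℝ)| := by
    rw [← habs]
    exact_mod_cast h2
  have hp : (0 : ℝ) < 2 ^ (l + 1) := by positivity
  have hθabs : |θ| = 2 * Real.pi * |(n : ℝ)| / 2 ^ (l + 1) := by
    rw [hθ, abs_mul, abs_mul, abs_of_pos (by positivity : 0 < 2 * Real.pi),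
      abs_of_pos (inv_pos.2 hp), div_eq_mul_inv]
  -- The step 2^(-(l+1)) places the angle between π/2 and π, so the cosine is nonpositive and the
  -- real part of the symbol is at most -1.
  have hlo : Real.pi / 2 ≤ |θ| := by
    rw [hθabs, le_div_iff₀ hp, pow_succ]
    nlinarith [Real.pi_pos]
  have hhi : |θ| ≤ Real.pi := by
    rw [hθabs, div_le_iff₀ hp, pow_succ]
    nlinarith [Real.pi_pos]
  have hcos : Real.cos θ ≤ 0 := by
    rw [← Real.cos_abs]
    exact Real.cos_nonpos_of_pi_div_two_le_of_le hlo (by linarith [Real.pi_pos])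
  rw [e]
  refine le_trans ?_ (Complex.abs_re_le_norm _)
  rw [Complex.sub_re, Complex.exp_ofReal_mul_I_re, Complex.one_re, le_abs]
  right
  linarith

end Torus

/-! ### Summation over wavelet levels and frequency blocks -/

section Norms

variable {d m r : ℕ} {s σ : ℝ} {f : UnitAddTorus (Fin d) → ℂ}

theorem absOne_eq_sum (j : Fin d → ℤ) : (absOne j : ℝ) = ∑ i, ((j i).toNat : ℝ) := by
  rw [absOne, Finset.sum_filter, Int.cast_sum]
  refine Finset.sum_congr rfl fun i _ => ?_
  split_ifs with h
  · lift j i to ℕ using h with J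
    simp
  · rw [Int.toNat_of_nonpos (by omega)]
    simp

theorem two_rpow_absOne (j : Fin d → ℤ) (s : ℝ) :
    (2 : ℝ≥0∞) ^ (2 * (absOne j : ℝ) * s) = ∏ i, (2 : ℝ≥0∞) ^ (2 * ((j i).toNat : ℝ) * s) := by
  rw [absOne_eq_sum, Finset.mul_sum, Finset.sum_mul]
  induction (Finset.univ : Finset (Fin d)) using Finset.induction_on with
  | empty => simp
  | insert i t hi ih =>
    rw [Finset.sum_insert hi, Finset.prod_insert hi, ← ih,
      ENNReal.rpow_add _ _ two_ne_zero ENNReal.ofNat_ne_top]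

/-- Sums over the levels of products over the coordinates. -/
theorem tsum_level_prod (g : Fin d → ℤ → ℝ≥0∞) :
    ∑' j : Level d, ∏ i, g i (j.1 i) = ∏ i, ∑' a : {a : ℤ // -1 ≤ a}, g i a.1 := by
  rw [← tsum_pi_prod fun i (a : {a : ℤ // -1 ≤ a}) => g i a.1]
  exact (Equiv.subtypePiEquivPi (p := fun (_ : Fin d) (a : ℤ) => -1 ≤ a)).tsum_eq
    fun x => ∏ i, g i (x i).1

/-- The combined constant of the summation over the levels. -/
noncomputable def levelConst (s σ : ℝ) : ℝ≥0∞ := 4 ^ s * (2 ^ (2 * σ) * geomConst σ)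

theorem levelConst_ne_top (hs : 0 < s) (hσ : 0 < σ) : levelConst s σ ≠ ⊤ :=
  ENNReal.mul_ne_top (ENNReal.rpow_ne_top_of_nonneg hs.le (by simp))
    (ENNReal.mul_ne_top (ENNReal.rpow_ne_top_of_nonneg (by linarith) (by simp))
      (geomConst_ne_top hσ))

theorem geomConst_le_levelConst (hs : 0 < s) (hσ : 0 < σ) : geomConst σ ≤ levelConst s σ := by
  have h1 : (1 : ℝ≥0∞) ≤ 4 ^ s := ENNReal.one_le_rpow (by norm_num) hs
  have h2 : (1 : ℝ≥0∞) ≤ 2 ^ (2 * σ) := ENNReal.one_le_rpow one_le_two (by linarith)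
  calc geomConst σ = 1 * (1 * geomConst σ) := by rw [one_mul, one_mul]
    _ ≤ _ := by
      unfold levelConst
      gcongr

theorem two_rpow_dyadicLevel_le (hs : 0 < s) (n : ℤ) :
    (2 : ℝ≥0∞) ^ (2 * (dyadicLevel n : ℝ) * s)
      ≤ 4 ^ s * ENNReal.ofReal ((1 + (n : ℝ) ^ 2) ^ s) := by
  have h : (2 : ℝ) ^ (2 * dyadicLevel n) ≤ 4 * (1 + (n : ℝ) ^ 2) := by
    by_cases hn : dyadicLevel n = 0
    · rw [hn]
      norm_num
      nlinarith [sq_nonneg (n : ℝ)]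
    · have h1 := two_pow_le_two_mul_natAbs hn
      have h2 : (2 : ℝ) ^ dyadicLevel n ≤ 2 * |(n : ℝ)| := by
        rw [← Int.cast_abs, Int.abs_eq_natAbs, Int.cast_natCast]
        exact_mod_cast h1
      rw [mul_comm 2, pow_mul]
      have h3 : (0 : ℝ) ≤ 2 ^ dyadicLevel n := by positivity
      nlinarith [sq_abs (n : ℝ), abs_nonneg (n : ℝ)]
  have h4 : (2 : ℝ≥0∞) ^ (2 * (dyadicLevel n : ℝ) * s)
      = ENNReal.ofReal ((2 : ℝ) ^ (2 * dyadicLevel n)) ^ s := by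
    rw [ENNReal.ofReal_pow zero_le_two, ENNReal.ofReal_ofNat, ← ENNReal.rpow_natCast,
      ← ENNReal.rpow_mul]
    push_cast
    ring_nf
  rw [h4, ← ENNReal.ofReal_rpow_of_pos (by positivity),
    ← ENNReal.mul_rpow_of_nonneg _ _ hs.le]
  refine ENNReal.rpow_le_rpow ((ENNReal.ofReal_le_ofReal h).trans_eq ?_) hs.le
  rw [ENNReal.ofReal_mul (by norm_num), ENNReal.ofReal_ofNat]

theorem tsum_level_weight_le (hs : 0 < s) (hσ : 0 < σ) (h₁ : σ ≤ s) (h₂ : σ ≤ m - s) (n : ℤ) :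
    ∑' j : {j : ℤ // -1 ≤ j}, (2 : ℝ≥0∞) ^ (2 * (j.1.toNat : ℝ) * s) * (freqWeight m j.1 n)⁻¹
      ≤ levelConst s σ * ENNReal.ofReal ((1 + (n : ℝ) ^ 2) ^ s) := by
  calc _ ≤ ∑' j : {j : ℤ // -1 ≤ j}, (2 : ℝ≥0∞) ^ (2 * (dyadicLevel n : ℝ) * s) *
          2 ^ (-(2 * σ * |(j.1.toNat : ℝ) - dyadicLevel n|)) :=
        ENNReal.tsum_le_tsum fun j => level_interaction h₁ h₂ _ _
    _ ≤ 2 ^ (2 * (dyadicLevel n : ℝ) * s) * (2 ^ (2 * σ) * geomConst σ) := by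
        rw [ENNReal.tsum_mul_left]
        gcongr
        exact tsum_level_interaction_le σ hσ _
    _ ≤ (4 ^ s * ENNReal.ofReal ((1 + (n : ℝ) ^ 2) ^ s)) * (2 ^ (2 * σ) * geomConst σ) := by
        gcongr
        exact two_rpow_dyadicLevel_le hs n
    _ = _ := by
        rw [levelConst]
        ring

theorem inv_prod_freqWeight (j n : Fin d → ℤ) :
    (∏ i, freqWeight m (j i) (n i))⁻¹ = ∏ i, (freqWeight m (j i) (n i))⁻¹ :=
  ENNReal.prod_inv_distrib fun _ _ _ _ _ => .inl (freqWeight_ne_zero _ _ _)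

/-! ## The Sobolev norm -/

/-- After exchanging the sums, the sum over levels at a fixed frequency factors into one-dimensional
sums. -/
theorem tsum_level_energy_le_sobolev (hs : 0 < s) (hσ : 0 < σ) (h₁ : σ ≤ s) (h₂ : σ ≤ m - s)
    (c : (Fin d → ℤ) → ℂ) :
    ∑' j : Level d, (2 : ℝ≥0∞) ^ (2 * (absOne j.1 : ℝ) * s) *
        ∑' n : Fin d → ℤ, (∏ i, freqWeight m (j.1 i) (n i))⁻¹ * ‖c n‖ₑ ^ 2
      ≤ levelConst s σ ^ d * ∑' n : Fin d → ℤ, ‖c n‖ₑ ^ 2 *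
        ENNReal.ofReal (∏ i, (1 + (n i : ℝ) ^ 2) ^ s) := by
  simp_rw [← ENNReal.tsum_mul_left]
  rw [ENNReal.tsum_comm]
  refine ENNReal.tsum_le_tsum fun n => ?_
  calc _ = (∑' j : Level d, ∏ i, ((2 : ℝ≥0∞) ^ (2 * ((j.1 i).toNat : ℝ) * s) *
          (freqWeight m (j.1 i) (n i))⁻¹)) * ‖c n‖ₑ ^ 2 := by
        rw [← ENNReal.tsum_mul_right]
        refine tsum_congr fun j => ?_
        rw [two_rpow_absOne, inv_prod_freqWeight, Finset.prod_mul_distrib, mul_assoc]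
    _ = (∏ i, ∑' j : {j : ℤ // -1 ≤ j}, (2 : ℝ≥0∞) ^ (2 * (j.1.toNat : ℝ) * s) *
          (freqWeight m j.1 (n i))⁻¹) * ‖c n‖ₑ ^ 2 := by
        rw [tsum_level_prod fun i a => (2 : ℝ≥0∞) ^ (2 * (a.toNat : ℝ) * s) *
          (freqWeight m a (n i))⁻¹]
    _ ≤ (∏ i, (levelConst s σ * ENNReal.ofReal ((1 + (n i : ℝ) ^ 2) ^ s))) * ‖c n‖ₑ ^ 2 := by
        gcongr with i
        exact tsum_level_weight_le hs hσ h₁ h₂ (n i)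
    _ = _ := by
        rw [Finset.prod_mul_distrib, Finset.prod_const, Finset.card_univ, Fintype.card_fin,
          ENNReal.ofReal_prod_of_nonneg fun _ _ => by positivity]
        ring

/-! ## The Besov norm -/

/-- The energy of a dyadic block of frequencies is controlled by the Besov norm. -/
theorem block_energy_le_besov (hs : 0 < s) (hf : MemLp f 2 (torusMeasure d)) (l : Fin d → ℕ) :
    (∏ i, (2 : ℝ≥0∞) ^ (2 * (l i : ℝ) * s)) *
        ∑' n : Fin d → ℤ, (if (fun i => dyadicLevel (n i)) = l then ‖mFourierCoeff f n‖ₑ ^ 2 else 0)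
      ≤ besovNorm s r f ^ 2 := by
  classical
  -- Coordinates with `l i = 0` have frequency 0, where the symbol of a difference vanishes; no
  -- difference may be taken there.
  set u : Finset (Fin d) := Finset.univ.filter fun i => l i ≠ 0 with hu
  set h : Fin d → ℝ := fun i => (2 ^ (l i + 1))⁻¹ with hh
  have hpos : ∀ i, 0 < h i := fun i => by positivity
  have hblock : ∑' n : Fin d → ℤ,
      (if (fun i => dyadicLevel (n i)) = l then ‖mFourierCoeff f n‖ₑ ^ 2 else 0)
        ≤ eLpNorm (mixedDiff r u h f) 2 (torusMeasure d) ^ 2 := by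
    rw [← tsum_mFourierCoeff_sq (memLp_mixedDiff hf u h)]
    refine ENNReal.tsum_le_tsum fun n => ?_
    split_ifs with hn
    · rw [mFourierCoeff_mixedDiff hf, enorm_mul, mul_pow]
      refine le_mul_of_one_le_left' (one_le_pow₀ ?_)
      rw [← ofReal_norm, ENNReal.one_le_ofReal, norm_prod]
      refine Finset.prod_induction _ (1 ≤ ·) (fun _ _ => one_le_mul_of_one_le_of_one_le) le_rfl
        fun i hi => ?_
      have hi' : dyadicLevel (n i) = l i := congr_fun hn i
      have hli : l i ≠ 0 := (Finset.mem_filter.1 hi).2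
      rw [norm_pow]
      refine one_le_pow₀ ?_
      simp only [hh, ← hi'] at hli ⊢
      exact one_le_norm_fourier_sub_one hli
    · exact zero_le
  -- The steps give 2^((l+1)s) per coordinate of `u`, slightly more than needed; the other
  -- coordinates contribute 1.
  have hfactor : ∏ i, (2 : ℝ≥0∞) ^ ((l i : ℝ) * s) ≤ ENNReal.ofReal (∏ i ∈ u, |h i| ^ (-s)) := by
    rw [ENNReal.ofReal_prod_of_nonneg fun _ _ => by positivity,
      ← Finset.prod_filter_mul_prod_filter_not Finset.univ fun i => l i ≠ 0]
    have hone : ∏ i ∈ Finset.univ.filter fun i => ¬l i ≠ 0, (2 : ℝ≥0∞) ^ ((l i : ℝ) * s) = 1 := by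
      refine Finset.prod_eq_one fun i hi => ?_
      simp only [ne_eq, not_not, Finset.mem_filter, Finset.mem_univ, true_and] at hi
      simp [hi]
    rw [hone, mul_one]
    refine Finset.prod_le_prod' fun i _ => ?_
    rw [abs_of_pos (hpos i), hh, Real.rpow_neg (by positivity), Real.inv_rpow (by positivity),
      inv_inv, ← ENNReal.ofReal_rpow_of_pos (by positivity), ENNReal.ofReal_pow zero_le_two,
      ENNReal.ofReal_ofNat, ← ENNReal.rpow_natCast, ← ENNReal.rpow_mul]
    refine ENNReal.rpow_le_rpow_of_exponent_le one_le_two ?_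
    push_cast
    nlinarith
  have hbesov : ENNReal.ofReal (∏ i ∈ u, |h i| ^ (-s)) *
      eLpNorm (mixedDiff r u h f) 2 (torusMeasure d) ≤ besovNorm s r f := by
    refine le_trans ?_ (Finset.single_le_sum (f := fun u : Finset (Fin d) =>
      ⨆ (h : Fin d → ℝ) (_ : ∀ i ∈ u, 0 < |h i| ∧ |h i| ≤ 1),
        ENNReal.ofReal (∏ i ∈ u, |h i| ^ (-s)) * eLpNorm (mixedDiff r u h f) 2 (torusMeasure d))
      (fun _ _ => zero_le) (Finset.mem_univ u))
    refine le_iSup₂_of_le h (fun i _ => ?_) le_rfl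
    rw [abs_of_pos (hpos i)]
    exact ⟨hpos i, inv_le_one_of_one_le₀ (one_le_pow₀ one_le_two)⟩
  calc _ ≤ (∏ i, (2 : ℝ≥0∞) ^ (2 * (l i : ℝ) * s)) *
          eLpNorm (mixedDiff r u h f) 2 (torusMeasure d) ^ 2 := by gcongr
    _ = ((∏ i, (2 : ℝ≥0∞) ^ ((l i : ℝ) * s)) *
          eLpNorm (mixedDiff r u h f) 2 (torusMeasure d)) ^ 2 := by
        rw [mul_pow, ← Finset.prod_pow]
        congr 1
        refine Finset.prod_congr rfl fun i _ => ?_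
        rw [← ENNReal.rpow_natCast, ← ENNReal.rpow_mul]
        push_cast
        ring_nf
    _ ≤ _ := by
        gcongr
        exact (mul_le_mul_left hfactor _).trans hbesov

/-- Frequencies are grouped into dyadic blocks, each bounded by the same Besov norm. The
off-diagonal decay makes the sum over blocks converge uniformly in `j`. -/
theorem level_energy_le_besov (hs : 0 < s) (h₁ : σ ≤ s) (h₂ : σ ≤ m - s)
    (hf : MemLp f 2 (torusMeasure d)) (j : Fin d → ℤ) :
    (2 : ℝ≥0∞) ^ (2 * (absOne j : ℝ) * s) *
        ∑' n : Fin d → ℤ, (∏ i, freqWeight m (j i) (n i))⁻¹ * ‖mFourierCoeff f n‖ₑ ^ 2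
      ≤ geomConst σ ^ d * besovNorm s r f ^ 2 := by
  classical
  set W : (Fin d → ℕ) → ℝ≥0∞ := fun l =>
    ∏ i, (2 : ℝ≥0∞) ^ (-(2 * σ * |((j i).toNat : ℝ) - l i|)) with hW
  set P : (Fin d → ℕ) → ℝ≥0∞ := fun l => ∏ i, (2 : ℝ≥0∞) ^ (2 * (l i : ℝ) * s) with hP
  have hterm : ∀ n : Fin d → ℤ, (2 : ℝ≥0∞) ^ (2 * (absOne j : ℝ) * s) *
      ((∏ i, freqWeight m (j i) (n i))⁻¹ * ‖mFourierCoeff f n‖ₑ ^ 2)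
        ≤ ∑' l : Fin d → ℕ, W l * (P l *
          if (fun i => dyadicLevel (n i)) = l then ‖mFourierCoeff f n‖ₑ ^ 2 else 0) := by
    intro n
    refine le_trans ?_ (ENNReal.le_tsum fun i => dyadicLevel (n i))
    rw [if_pos rfl, ← mul_assoc, ← mul_assoc, two_rpow_absOne, inv_prod_freqWeight,
      ← Finset.prod_mul_distrib, hW, hP, ← Finset.prod_mul_distrib]
    refine mul_le_mul_left (Finset.prod_le_prod' fun i _ => ?_) _
    exact (level_interaction h₁ h₂ _ _).trans_eq (mul_comm _ _)
  calc _ ≤ ∑' n : Fin d → ℤ, ∑' l : Fin d → ℕ, W l * (P l *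
          if (fun i => dyadicLevel (n i)) = l then ‖mFourierCoeff f n‖ₑ ^ 2 else 0) := by
        rw [← ENNReal.tsum_mul_left]
        exact ENNReal.tsum_le_tsum hterm
    _ ≤ ∑' l : Fin d → ℕ, W l * besovNorm s r f ^ 2 := by
        rw [ENNReal.tsum_comm]
        refine ENNReal.tsum_le_tsum fun l => ?_
        rw [ENNReal.tsum_mul_left, ENNReal.tsum_mul_left]
        gcongr
        exact block_energy_le_besov hs hf l
    _ = (∏ i, ∑' l : ℕ, (2 : ℝ≥0∞) ^ (-(2 * σ * |((j i).toNat : ℝ) - l|))) *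
          besovNorm s r f ^ 2 := by
        rw [ENNReal.tsum_mul_right,
          tsum_pi_prod fun i (l : ℕ) => (2 : ℝ≥0∞) ^ (-(2 * σ * |((j i).toNat : ℝ) - l|))]
    _ ≤ (∏ _i : Fin d, geomConst σ) * besovNorm s r f ^ 2 := by
        gcongr with i
        exact tsum_level_interaction_nat_le σ _
    _ = _ := by rw [Finset.prod_const, Finset.card_univ, Fintype.card_fin]

end Norms

end MixedWavelet

/-! ### The main theorem -/

open MixedWavelet in
theorem mainTheorem1
    (d m : ℕ) (s : ℝ) (hs : 0 < s) (hsm : s < m)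
    (r : ℕ) (hr : s < r)
    (S γ δ : ℝ) (hγ : 0 < γ) :
    ∃ C : ℝ≥0, 0 < C ∧
      ∀ ψ : ℝ → ℝ, MemLp ψ 2 volume →
        HasSupport ψ S → HasVanishingMoments ψ m → IsPeriodicRiesz ψ γ δ →
      ∀ ψ' : ℤ → ℤ → UnitAddCircle → ℂ, IsDual ψ ψ' →
      ∀ f : UnitAddTorus (Fin d) → ℂ, MemLp f 2 (torusMeasure d) →
        (∑' j : Level d, (2 : ℝ≥0∞) ^ (2 * (absOne j.1 : ℝ) * s) * levelEnergy ψ' f j.1)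
            ^ (1 / 2 : ℝ)
          ≤ C * hmixNorm s f ∧
        (⨆ j : Level d,
            (2 : ℝ≥0∞) ^ ((absOne j.1 : ℝ) * s) * levelEnergy ψ' f j.1 ^ (1 / 2 : ℝ))
          ≤ C * besovNorm s r f := by
  obtain ⟨σ, hσ, h₁, h₂⟩ : ∃ σ : ℝ, 0 < σ ∧ σ ≤ s ∧ σ ≤ m - s :=
    ⟨min s (m - s), lt_min hs (by linarith), min_le_left _ _, min_le_right _ _⟩
  set B : ℝ≥0∞ := dualConst m S γ δ ^ d * levelConst s σ ^ d with hB
  have hBt : B ≠ ⊤ := ENNReal.mul_ne_top (ENNReal.pow_ne_top (dualConst_ne_top m S γ δ))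
    (ENNReal.pow_ne_top (levelConst_ne_top hs hσ))
  have hBrt : B ^ (1 / 2 : ℝ) ≠ ⊤ := ENNReal.rpow_ne_top_of_nonneg (by norm_num) hBt
  have hC : B ^ (1 / 2 : ℝ) ≤ ((B ^ (1 / 2 : ℝ)).toNNReal + 1 : ℝ≥0) := by
    rw [ENNReal.coe_add, ENNReal.coe_toNNReal hBrt]
    exact le_self_add
  -- The summand 1 makes positivity of the constant immediate; the constant is fixed before `ψ`, the
  -- duals and `f` are introduced.
  refine ⟨(B ^ (1 / 2 : ℝ)).toNNReal + 1, by positivity, ?_⟩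
  intro ψ h2 hsupp hm hR ψ' hd f hf
  have hlevel : ∀ j : Level d, levelEnergy ψ' f j.1 ≤ dualConst m S γ δ ^ d *
      ∑' n : Fin d → ℤ, (∏ i, freqWeight m (j.1 i) (n i))⁻¹ *
        ‖UnitAddTorus.mFourierCoeff f n‖ₑ ^ 2 := fun j =>
    levelEnergy_le_of_energy_le (by simp [dualConst]) (dualConst_ne_top m S γ δ) j.1
      (fun i => freqWeight m (j.1 i)) (fun i n => freqWeight_ne_zero _ _ _)
      (fun i n => freqWeight_ne_top _ _ _) (fun i k hk => memLp_dual hsupp h2 hd (j.2 i) hk)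
      (fun i y => dual_energy_le hγ hsupp h2 hm hR hd (j.2 i) y) hf
  constructor
  · refine le_trans ?_ (mul_le_mul_left hC _)
    rw [hmixNorm, ← ENNReal.mul_rpow_of_nonneg _ _ (by norm_num)]
    refine ENNReal.rpow_le_rpow ?_ (by norm_num)
    calc _ ≤ ∑' j : Level d, dualConst m S γ δ ^ d * ((2 : ℝ≥0∞) ^ (2 * (absOne j.1 : ℝ) * s) *
          ∑' n : Fin d → ℤ, (∏ i, freqWeight m (j.1 i) (n i))⁻¹ *
            ‖UnitAddTorus.mFourierCoeff f n‖ₑ ^ 2) :=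
          ENNReal.tsum_le_tsum fun j => by
            rw [mul_left_comm]
            exact mul_le_mul_right (hlevel j) _
      _ ≤ _ := by
          rw [ENNReal.tsum_mul_left, hB, mul_assoc]
          gcongr
          exact tsum_level_energy_le_sobolev hs hσ h₁ h₂ _
  · refine iSup_le fun j => le_trans ?_ (mul_le_mul_left hC _)
    have hsq : ∀ x : ℝ≥0∞, (x ^ 2) ^ (1 / 2 : ℝ) = x := fun x => by
      rw [← ENNReal.rpow_natCast, ← ENNReal.rpow_mul]
      norm_num
    have h2pow : (2 : ℝ≥0∞) ^ ((absOne j.1 : ℝ) * s)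
        = (2 ^ (2 * (absOne j.1 : ℝ) * s)) ^ (1 / 2 : ℝ) := by
      rw [← ENNReal.rpow_mul]
      ring_nf
    rw [← hsq (besovNorm s r f), h2pow, ← ENNReal.mul_rpow_of_nonneg _ _ (by norm_num),
      ← ENNReal.mul_rpow_of_nonneg _ _ (by norm_num)]
    refine ENNReal.rpow_le_rpow ?_ (by norm_num)
    calc _ ≤ dualConst m S γ δ ^ d * ((2 : ℝ≥0∞) ^ (2 * (absOne j.1 : ℝ) * s) *
          ∑' n : Fin d → ℤ, (∏ i, freqWeight m (j.1 i) (n i))⁻¹ *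
            ‖UnitAddTorus.mFourierCoeff f n‖ₑ ^ 2) := by
          rw [mul_left_comm]
          exact mul_le_mul_right (hlevel j) _
      _ ≤ dualConst m S γ δ ^ d * (geomConst σ ^ d * besovNorm s r f ^ 2) :=
          mul_le_mul_right (level_energy_le_besov hs h₁ h₂ hf j.1) _
      _ ≤ _ := by
          rw [hB, mul_assoc]
          gcongr
          exact geomConst_le_levelConst hs hσ
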